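/- Let $\Gamma\subset\mathbb{R}^n$ be a lattice, i.e. $\Gamma=\bigoplus_{j=1}^n\mathbb{Z}\varepsilon_j$ for some basis $\varepsilon_1,\dots,\varepsilon_n$ of $\mathbb{R}^n$. **Notation.** For $\chi\in C_0^\infty(\mathbb{R}^n)\setminus\{0\}$, $1\le p\le\infty$ and $u\in\mathcal{S}'(\mathbb{R}^n)$ put $$U_{\chi,p}(\xi)=\Bigl(\int_{\mathbb{R}^n}\bigl|\langle u,e^{-i\langle\cdot,\xi\rangle}\chi(\cdot-y)\rangle\bigr|^p\,dy\Bigr)^{1/p}\ (p<\infty),\qquad U_{\chi,\infty}(\xi)=\sup_{y\in\mathbb{R}^n}\bigl|\langle u,e^{-i\langle\cdot,\xi\rangle}\chi(\cdot-y)\rangle\bigr|,$$ and $\|u\|_{S_w^p,\chi}=\int_{\mathbb{R}^n}U_{\chi,p}(\xi)\,d\xi\in[0,\infty]$. One says that $u\in S_w^p(\mathbb{R}^n)$ if $\|u\|_{S_w^p,\chi}<\infty$ for some $\chi\in C_0^\infty(\mathbb{R}^n)\setminus\{0\}$. The Fourier transform on $\mathcal{S}'(\mathbb{R}^n)$ is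 the one extending $\widehat\varphi(\xi)=\int e^{-i\langle x,\xi\rangle}\varphi(x)\,dx$. For a compact set $Q\subset\mathbb{R}^n$, a *$Q$-decomposition* of $u$ in $L^p$ is a family $(u_\gamma)_{\gamma\in\Gamma}\subset L^p(\mathbb{R}^n)$ such that $$\operatorname{supp}\widehat{u}_\gamma\subset\gamma+Q\ \ (\gamma\in\Gamma),\qquad \sum_{\gamma\in\Gamma}\|u_\gamma\|_{L^p}<\infty,\qquad u=\sum_{\gamma\in\Gamma}u_\gamma\ \text{ in }\mathcal{S}'(\mathbb{R}^n).$$ **Theorem.** 1. For every $1\le p\le\infty$ and every $u\in\mathcal{S}'(\mathbb{R}^n)$: $u\in S_w^p(\mathbb{R}^n)$ if and only if there are a compact set $Q\subset\mathbb{R}^n$ and a $Q$-decomposition of $u$ in $L^p$. 2. There is a compact set $Q_\Gamma\subset\mathbb{R}^n$, depending only on $\Gamma$, and for each $\chi\in C_0^\infty(\mathbb{R}^n)\setminus\{0\}$ a constant $C_{\Gamma,\chi}$, such that for all $1\le p\le\infty$ every $u\in S_w^p(\mathbb{R}^n)$ has a $Q_\Gamma$-decomposition $(u_\gamma)$ in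 $L^p$ with $$\sum_{\gamma\in\Gamma}\|u_\gamma\|_{L^p}\le C_{\Gamma,\chi}\,\|u\|_{S_w^p,\chi}\quad\text{for all }\chi\in C_0^\infty(\mathbb{R}^n)\setminus\{0\}.$$ 3. For every compact $Q\subset\mathbb{R}^n$ and every $\chi\in C_0^\infty(\mathbb{R}^n)\setminus\{0\}$ there is a constant $C_{\Gamma,Q,\chi}$ such that for all $1\le p\le\infty$, all $u\in\mathcal{S}'(\mathbb{R}^n)$ and all $Q$-decompositions $(u_\gamma)$ of $u$ in $L^p$, $$\|u\|_{S_w^p,\chi}\le C_{\Gamma,Q,\chi}\sum_{\gamma\in\Gamma}\|u_\gamma\|_{L^p}.$$ In particular $\|u\|_{S_w^p,\chi}\approx\sum_{\gamma}\|u_\gamma\|_{L^p}$ for the decompositions in 2. -/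

import Mathlib

open MeasureTheory Distribution TemperedDistribution
open scoped ENNReal NNReal SchwartzMap FourierTransform

noncomputable section

namespace SpectralSw

/-- The oscillating function `t ↦ e^{-it}` on the real line has temperate growth. -/
theorem hasTemperateGrowth_cexp_real :
    (fun t : ℝ => Complex.exp (-Complex.I * (t : ℂ))).HasTemperateGrowth := by
  have hcd : ContDiff ℝ (⊤ : ℕ∞) (fun t : ℝ => Complex.exp (-Complex.I * (t : ℂ))) :=
    Complex.contDiff_exp.comp (contDiff_const.mul Complex.ofRealCLM.contDiff)
  refine ⟨hcd, fun m => ⟨0, 1, fun t => ?_⟩⟩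
  have hd : ∀ (k : ℕ) (c : ℂ),
      iteratedDeriv k (fun t : ℝ => c * Complex.exp (-Complex.I * (t : ℂ)))
        = fun t : ℝ => (c * (-Complex.I) ^ k) * Complex.exp (-Complex.I * (t : ℂ)) := by
    intro k
    induction k with
    | zero => intro c; simp
    | succ k ih =>
      intro c
      have h1 : deriv (fun t : ℝ => c * Complex.exp (-Complex.I * (t : ℂ)))
          = fun t : ℝ => (c * (-Complex.I)) * Complex.exp (-Complex.I * (t : ℂ)) := by
        funext s
        have h2 : HasDerivAt (fun t : ℝ => -Complex.I * (t : ℂ)) (-Complex.I * 1) s :=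
          (Complex.ofRealCLM.hasDerivAt (x := s)).const_mul _
        rw [(h2.cexp.const_mul c).deriv]
        ring
      rw [iteratedDeriv_succ', h1, ih]
      funext s
      ring
  have h := hd m 1
  simp only [one_mul] at h
  rw [norm_iteratedFDeriv_eq_norm_iteratedDeriv, h]
  simp [Complex.norm_exp]

/-- For fixed `ξ`, the character `x ↦ e^{-i⟨x, ξ⟩}` has temperate growth. -/
theorem hasTemperateGrowth_character {n : ℕ} (ξ : EuclideanSpace ℝ (Fin n)) :
    (fun x : EuclideanSpace ℝ (Fin n) =>
      Complex.exp (-Complex.I * ((inner ℝ x ξ : ℝ) : ℂ))).HasTemperateGrowth :=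
  hasTemperateGrowth_cexp_real.comp (by fun_prop)

/-- The Schwartz function `x ↦ e^{-i⟨x, ξ⟩} χ(x - y)`. -/
def modTranslate {n : ℕ} (χ : 𝓢(EuclideanSpace ℝ (Fin n), ℂ))
    (y ξ : EuclideanSpace ℝ (Fin n)) : 𝓢(EuclideanSpace ℝ (Fin n), ℂ) :=
  SchwartzMap.smulLeftCLM ℂ
    (fun x : EuclideanSpace ℝ (Fin n) => Complex.exp (-Complex.I * ((inner ℝ x ξ : ℝ) : ℂ)))
    (SchwartzMap.compSubConstCLM ℂ y χ)

theorem modTranslate_apply {n : ℕ} (χ : 𝓢(EuclideanSpace ℝ (Fin n), ℂ))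
    (y ξ x : EuclideanSpace ℝ (Fin n)) :
    modTranslate χ y ξ x = Complex.exp (-Complex.I * ((inner ℝ x ξ : ℝ) : ℂ)) * χ (x - y) := by
  rw [modTranslate, SchwartzMap.smulLeftCLM_apply_apply (hasTemperateGrowth_character ξ),
    smul_eq_mul, SchwartzMap.compSubConstCLM_apply]

/-- The Fourier transform of `u · τ_y χ` at `ξ`, that is `⟨u, e^{-i⟨·, ξ⟩} χ(· - y)⟩`. -/
def localFourier {n : ℕ} (u : 𝓢'(EuclideanSpace ℝ (Fin n), ℂ))
    (χ : 𝓢(EuclideanSpace ℝ (Fin n), ℂ)) (y ξ : EuclideanSpace ℝ (Fin n)) : ℂ :=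
  u (modTranslate χ y ξ)

/-- The function `U_{χ,p}`: the `L^p` norm (for `p = ∞`: the supremum) in the variable `y` of the
Fourier transform of `u · τ_y χ` at `ξ`, as an extended nonnegative number. -/
def windowFun {n : ℕ} (p : ℝ≥0∞) (χ : 𝓢(EuclideanSpace ℝ (Fin n), ℂ))
    (u : 𝓢'(EuclideanSpace ℝ (Fin n), ℂ)) (ξ : EuclideanSpace ℝ (Fin n)) : ℝ≥0∞ :=
  if p = ∞ then ⨆ y, ‖localFourier u χ y ξ‖ₑ
  else (∫⁻ y, ‖localFourier u χ y ξ‖ₑ ^ p.toReal) ^ (1 / p.toReal)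

/-- The norm of `S_w^p` with window `χ`, i.e. the `L^1` norm of `U_{χ,p}`
(infinite when this function, which is always measurable, is not integrable). -/
def swNorm {n : ℕ} (p : ℝ≥0∞) (χ : 𝓢(EuclideanSpace ℝ (Fin n), ℂ))
    (u : 𝓢'(EuclideanSpace ℝ (Fin n), ℂ)) : ℝ≥0∞ :=
  ∫⁻ ξ, windowFun p χ u ξ

/-- An admissible window: a nonzero function in `C_0^∞`. -/
def IsWindow {n : ℕ} (χ : 𝓢(EuclideanSpace ℝ (Fin n), ℂ)) : Prop :=
  HasCompactSupport χ ∧ χ ≠ 0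

/-- `u ∈ S_w^p(ℝⁿ)`: for some window `χ`, the function `U_{χ,p}` belongs to `L^1`. -/
def MemSw {n : ℕ} (p : ℝ≥0∞) (u : 𝓢'(EuclideanSpace ℝ (Fin n), ℂ)) : Prop :=
  ∃ χ : 𝓢(EuclideanSpace ℝ (Fin n), ℂ), IsWindow χ ∧ swNorm p χ u < ∞

/-- The dilation `x ↦ (2π)⁻¹ x` of `ℝⁿ`. -/
def dilation (n : ℕ) : EuclideanSpace ℝ (Fin n) ≃L[ℝ] EuclideanSpace ℝ (Fin n) :=
  ContinuousLinearEquiv.smulLeft (Units.mk0 ((2 * Real.pi)⁻¹ : ℝ) (by positivity))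

/-- The Fourier transform `φ̂(ξ) = ∫ e^{-i⟨x, ξ⟩} φ(x) dx` of Schwartz functions. -/
def schwartzHat (n : ℕ) :
    𝓢(EuclideanSpace ℝ (Fin n), ℂ) →L[ℂ] 𝓢(EuclideanSpace ℝ (Fin n), ℂ) :=
  (SchwartzMap.compCLMOfContinuousLinearEquiv ℂ (dilation n)).comp
    (FourierTransform.fourierCLM ℂ 𝓢(EuclideanSpace ℝ (Fin n), ℂ))

theorem schwartzHat_apply {n : ℕ} (φ : 𝓢(EuclideanSpace ℝ (Fin n), ℂ))
    (ξ : EuclideanSpace ℝ (Fin n)) :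
    schwartzHat n φ ξ = ∫ x, Complex.exp (-Complex.I * ((inner ℝ x ξ : ℝ) : ℂ)) * φ x := by
  have h1 : schwartzHat n φ ξ = 𝓕 (φ : EuclideanSpace ℝ (Fin n) → ℂ) ((2 * Real.pi)⁻¹ • ξ) := by
    rw [← SchwartzMap.fourier_coe]
    rfl
  rw [h1, Real.fourier_eq']
  refine integral_congr_ae (Filter.Eventually.of_forall fun x => ?_)
  have hpi : (Real.pi : ℂ) ≠ 0 := by exact_mod_cast Real.pi_ne_zero
  simp only [smul_eq_mul, inner_smul_right]
  congr 2
  push_cast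
  field_simp

/-- The Fourier transform of tempered distributions, `⟨û, φ⟩ = ⟨u, φ̂⟩`, with the normalization
`φ̂(ξ) = ∫ e^{-i⟨x, ξ⟩} φ(x) dx`. -/
def distHat {n : ℕ} (u : 𝓢'(EuclideanSpace ℝ (Fin n), ℂ)) :
    𝓢'(EuclideanSpace ℝ (Fin n), ℂ) :=
  PointwiseConvergenceCLM.precomp ℂ (schwartzHat n) u

theorem distHat_apply {n : ℕ} (u : 𝓢'(EuclideanSpace ℝ (Fin n), ℂ))
    (φ : 𝓢(EuclideanSpace ℝ (Fin n), ℂ)) : distHat u φ = u (schwartzHat n φ) := rfl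

/-- The family `v = (v_γ)` in `L^p`, indexed by the lattice `Γ`, is a decomposition of `u` with
spectra in the translates `γ + Q`: `supp v̂_γ ⊆ γ + Q` for all `γ`, `∑ ‖v_γ‖_{L^p} < ∞`, and
`u = ∑ v_γ` with (unconditional) convergence in the space of tempered distributions. -/
structure IsSpectralDecomposition {n : ℕ} (Γ : Submodule ℤ (EuclideanSpace ℝ (Fin n)))
    (Q : Set (EuclideanSpace ℝ (Fin n))) (p : ℝ≥0∞) [Fact (1 ≤ p)]
    (u : 𝓢'(EuclideanSpace ℝ (Fin n), ℂ))
    (v : Γ → Lp ℂ p (volume : Measure (EuclideanSpace ℝ (Fin n)))) : Prop where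
  spectrum_subset : ∀ γ : Γ,
    dsupport (distHat (Lp.toTemperedDistribution (v γ))) ⊆
      (fun x => (γ : EuclideanSpace ℝ (Fin n)) + x) '' Q
  norm_summable : ∑' γ : Γ, ‖v γ‖ₑ < ∞
  hasSum : HasSum (fun γ : Γ => Lp.toTemperedDistribution (v γ)) u

end SpectralSw

end

/-!
Write `H` for the Fourier transform of Schwartz functions and `φ(D) u` for the distribution with
Fourier transform `φ û`. The norm of `S_w^p` and the sum of the norms of the pieces of a
decomposition are compared by localizing in frequency, in both directions.

*From a decomposition to the norm.* If the spectrum of `v` lies in `γ + Q` and `φ` is a cutoff equal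
to one near `Q`, then `v = φ(D - γ) v` (`apply_schwartzHat_mul_translate`), because a tempered
distribution vanishes on the Schwartz functions supported off its support
(`apply_eq_zero_of_disjoint_dsupport`). Hence the windowed Fourier transform of `v` at the
frequency `ξ` is a convolution of `v` with a kernel whose `L^1` norm decays rapidly in `ξ - γ`,
uniformly in `p`. Young's inequality, integration in `ξ` and summation over `γ` give
`exists_swNorm_le`.

*From the norm to a decomposition.* The regularized indicator function `φ` of a fundamental domain
of `Γ` is smooth with compact support, and its translates by `Γ` sum to one (`exists_partition`). So
`u` is the sum of the smooth functions `φ(D - γ) u` (`multiplier`,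
`apply_schwartzHat_mul_schwartzUnhat`, `hasSum_apply_mul_translate`), with spectra in the translates
of the support of `φ`. To bound them, let a window `χ` be given, and choose a smooth function `b`
supported near a point where `χ` does not vanish, with `b χ ≥ 0`, such that the inverse Fourier
transform `m` of `b χ` has no zeros on the support of `φ`
(`exists_schwartzUnhat_mul_ne_zero`). Then `φ = θ m` with a Schwartz function `θ`, and this
factorization expresses the convolution kernel of `φ(D - γ)` at `x` as an absolutely convergent
superposition of the time-frequency shifts `e^{-i⟨·, ξ⟩} χ(· - y)`, with weights of the size
`|H⁻¹b(ξ - γ)| |Hθ(y - x)|` (`kernel_eq_integral_modTranslate`). Applying `u` and Minkowski's integral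
inequality bounds the `L^p` norm of `φ(D - γ) u` by the integral of `|H⁻¹b(ξ - γ)| U_{χ,p}(ξ)`
(`lpSupNorm_multiplier_translate_le`). The sums of `|H⁻¹b(ξ - γ)|` over the lattice are bounded in
`ξ` (`exists_tsum_enorm_le`), which gives `exists_isSpectralDecomposition`.

Both parts apply tempered distributions under integrals and sums of Schwartz functions. This is
justified by `IsIntegrableFamily.apply_eq_integral`: a continuous functional on the Schwartz space
factors through a Banach space of bounded continuous functions, where a Bochner integral may be
used.
-/

noncomputable section

namespace SpectralSw

open scoped BoundedContinuousFunction LineDeriv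

/-! ### Integrals of families of Schwartz functions -/

section Pettis

variable {E : Type*} [NormedAddCommGroup E] [NormedSpace ℝ E]

variable (E) in
/-- The Banach space of bounded continuous functions with values in the `l`-linear forms. It is
not reducible, so that its topology is always the one of its norm. -/
def BoundedForms (l : ℕ) : Type _ := E →ᵇ (E [×l]→L[ℝ] ℂ)

instance (l : ℕ) : NormedAddCommGroup (BoundedForms E l) :=
  inferInstanceAs (NormedAddCommGroup (E →ᵇ (E [×l]→L[ℝ] ℂ)))

instance (l : ℕ) : NormedSpace ℂ (BoundedForms E l) :=
  inferInstanceAs (NormedSpace ℂ (E →ᵇ (E [×l]→L[ℝ] ℂ)))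

instance (l : ℕ) : CompleteSpace (BoundedForms E l) :=
  inferInstanceAs (CompleteSpace (E →ᵇ (E [×l]→L[ℝ] ℂ)))

/-- Evaluation of a bounded field of forms at a point and a tuple of vectors. -/
def evalForm {l : ℕ} (x : E) (m : Fin l → E) : BoundedForms E l →L[ℂ] ℂ :=
  LinearMap.mkContinuous
    { toFun := fun F => (show E →ᵇ (E [×l]→L[ℝ] ℂ) from F) x m
      map_add' := fun _ _ => rfl
      map_smul' := fun _ _ => rfl }
    (∏ i, ‖m i‖) (fun F => by
      have h1 := ((show E →ᵇ (E [×l]→L[ℝ] ℂ) from F) x).le_opNorm m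
      have h2 := (show E →ᵇ (E [×l]→L[ℝ] ℂ) from F).norm_coe_le_norm x
      refine h1.trans ?_
      rw [mul_comm]
      exact mul_le_mul_of_nonneg_left h2 (by positivity))

theorem BoundedForms.ext {l : ℕ} {F G : BoundedForms E l}
    (h : ∀ x m, evalForm x m F = evalForm x m G) : F = G :=
  BoundedContinuousFunction.ext fun x => ContinuousMultilinearMap.ext fun m => h x m

/-- The function `x ↦ ‖x‖ ^ k • D^l f x` as a bounded continuous function. -/
def weightedDerivFun (k l : ℕ) (f : 𝓢(E, ℂ)) : E →ᵇ (E [×l]→L[ℝ] ℂ) :=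
  BoundedContinuousFunction.ofNormedAddCommGroup
    (fun x => ‖x‖ ^ k • iteratedFDeriv ℝ l f x)
    ((continuous_norm.pow k).smul ((f.smooth l).continuous_iteratedFDeriv le_rfl))
    (SchwartzMap.seminorm ℂ k l f)
    (fun x => by rw [norm_smul, norm_pow, norm_norm]; exact SchwartzMap.le_seminorm ℂ k l f x)

theorem weightedDerivFun_apply (k l : ℕ) (f : 𝓢(E, ℂ)) (x : E) :
    weightedDerivFun k l f x = ‖x‖ ^ k • iteratedFDeriv ℝ l f x := rfl

theorem seminorm_le_norm_weightedDerivFun (k l : ℕ) (f : 𝓢(E, ℂ)) :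
    SchwartzMap.seminorm ℂ k l f ≤ ‖weightedDerivFun k l f‖ := by
  refine SchwartzMap.seminorm_le_bound ℂ k l f (norm_nonneg (weightedDerivFun k l f)) fun x => ?_
  have h := (weightedDerivFun k l f).norm_coe_le_norm x
  rwa [weightedDerivFun_apply, norm_smul, norm_pow, norm_norm] at h

theorem norm_weightedDerivFun_le (k l : ℕ) (f : 𝓢(E, ℂ)) :
    ‖weightedDerivFun k l f‖ ≤ SchwartzMap.seminorm ℂ k l f := by
  refine (BoundedContinuousFunction.norm_le (apply_nonneg _ _)).2 fun x => ?_
  rw [weightedDerivFun_apply, norm_smul, norm_pow, norm_norm]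
  exact SchwartzMap.le_seminorm ℂ k l f x

/-- The Schwartz seminorm with indices `k`, `l` is the norm of the bounded continuous function
`x ↦ ‖x‖ ^ k • D^l f x`, which depends linearly on `f`. -/
def weightedDeriv (k l : ℕ) : 𝓢(E, ℂ) →L[ℂ] BoundedForms E l :=
  SchwartzMap.mkCLMtoNormedSpace (G := BoundedForms E l) (weightedDerivFun k l)
    (fun f g => by
      refine BoundedContinuousFunction.ext fun x => ?_
      have h : iteratedFDeriv ℝ l (f + g : 𝓢(E, ℂ)) x
          = iteratedFDeriv ℝ l f x + iteratedFDeriv ℝ l g x := by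
        have := iteratedFDeriv_add_apply (x := x) (f.smooth l).contDiffAt (g.smooth l).contDiffAt
        simpa using this
      rw [weightedDerivFun_apply, h, smul_add]
      rfl)
    (fun a f => by
      refine BoundedContinuousFunction.ext fun x => ?_
      have h : iteratedFDeriv ℝ l (a • f : 𝓢(E, ℂ)) x = a • iteratedFDeriv ℝ l f x := by
        have := iteratedFDeriv_const_smul_apply (x := x) (a := a) (f.smooth l).contDiffAt
        simpa using this
      rw [weightedDerivFun_apply, h, smul_comm]
      rfl)
    ⟨{(k, l)}, 1, zero_le_one, fun f => by
      rw [Finset.sup_singleton, one_mul]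
      exact norm_weightedDerivFun_le k l f⟩

theorem evalForm_weightedDeriv (k l : ℕ) (f : 𝓢(E, ℂ)) (x : E) (m : Fin l → E) :
    evalForm x m (weightedDeriv k l f) = ‖x‖ ^ k • iteratedFDeriv ℝ l f x m := rfl

theorem seminorm_le_norm_weightedDeriv (k l : ℕ) (f : 𝓢(E, ℂ)) :
    SchwartzMap.seminorm ℂ k l f ≤ ‖weightedDeriv k l f‖ :=
  seminorm_le_norm_weightedDerivFun k l f

theorem norm_weightedDeriv_le (k l : ℕ) (f : 𝓢(E, ℂ)) :
    ‖weightedDeriv k l f‖ ≤ SchwartzMap.seminorm ℂ k l f :=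
  norm_weightedDerivFun_le k l f

/-- A continuous seminorm on the Schwartz space is dominated by a finite sum of the defining ones. -/
theorem exists_le_sum_seminorm (q : Seminorm ℂ 𝓢(E, ℂ)) (hq : Continuous q) :
    ∃ (s : Finset (ℕ × ℕ)) (C : ℝ), 0 ≤ C ∧
      ∀ f, q f ≤ C * ∑ i ∈ s, SchwartzMap.seminorm ℂ i.1 i.2 f := by
  obtain ⟨s, C, -, h⟩ := Seminorm.bound_of_continuous (schwartz_withSeminorms ℂ E ℂ) q hq
  refine ⟨s, C, C.coe_nonneg, fun f => (h f).trans ?_⟩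
  rw [smul_apply, NNReal.smul_def, smul_eq_mul]
  gcongr
  have := Seminorm.finset_sup_le_sum (schwartzSeminormFamily ℂ E ℂ) s f
  rwa [sum_apply] at this

theorem continuous_seminorm (k l : ℕ) :
    Continuous (SchwartzMap.seminorm ℂ k l : Seminorm ℂ 𝓢(E, ℂ)) :=
  (schwartz_withSeminorms ℂ E ℂ).continuous_seminorm (k, l)

variable {T : Type*} [TopologicalSpace T] [MeasurableSpace T] {μ : Measure T}

/-- A continuous family of Schwartz functions all of whose Schwartz seminorms are integrable. -/
structure IsIntegrableFamily (μ : Measure T) (f : T → 𝓢(E, ℂ)) : Prop where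
  continuous : Continuous f
  integrable : ∀ k l : ℕ, Integrable (fun t => SchwartzMap.seminorm ℂ k l (f t)) μ

variable [OpensMeasurableSpace T]

theorem IsIntegrableFamily.comp_seminorm {f : T → 𝓢(E, ℂ)} (hf : IsIntegrableFamily μ f)
    (q : Seminorm ℂ 𝓢(E, ℂ)) (hq : Continuous q) : Integrable (fun t => q (f t)) μ := by
  obtain ⟨s, C, hC, h⟩ := exists_le_sum_seminorm q hq
  refine Integrable.mono' (g := fun t => C * ∑ i ∈ s, SchwartzMap.seminorm ℂ i.1 i.2 (f t))
    ((integrable_finsetSum _ fun i _ => hf.integrable i.1 i.2).const_mul C)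
    (hq.comp hf.continuous).measurable.aestronglyMeasurable (.of_forall fun t => ?_)
  rw [Real.norm_of_nonneg (apply_nonneg _ _)]
  exact h (f t)

theorem IsIntegrableFamily.comp_clm {f : T → 𝓢(E, ℂ)} (hf : IsIntegrableFamily μ f)
    (A : 𝓢(E, ℂ) →L[ℂ] 𝓢(E, ℂ)) : IsIntegrableFamily μ (fun t => A (f t)) where
  continuous := A.continuous.comp hf.continuous
  integrable k l := by
    let q : Seminorm ℂ 𝓢(E, ℂ) := (SchwartzMap.seminorm ℂ k l).comp A.toLinearMap
    exact hf.comp_seminorm q ((continuous_seminorm k l).comp A.continuous)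

theorem IsIntegrableFamily.integrable_apply {f : T → 𝓢(E, ℂ)}
    (hf : IsIntegrableFamily μ f) (u : 𝓢(E, ℂ) →L[ℂ] ℂ) : Integrable (fun t => u (f t)) μ := by
  refine Integrable.mono' (hf.comp_seminorm ((normSeminorm ℂ ℂ).comp u.toLinearMap)
    (continuous_norm.comp u.continuous))
    (u.continuous.comp hf.continuous).measurable.aestronglyMeasurable (.of_forall fun t => le_rfl)

variable [SecondCountableTopology T]

/-- Differentiation under the integral sign for integrable families of Schwartz functions. -/
theorem IsIntegrableFamily.lineDerivOp_apply_eq_integral {f : T → 𝓢(E, ℂ)}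
    (hf : IsIntegrableFamily μ f) {g : 𝓢(E, ℂ)} (hg : ∀ x, g x = ∫ t, f t x ∂μ) (v x : E) :
    (∂_{v} g) x = ∫ t, (∂_{v} (f t)) x ∂μ := by
  have heval : ∀ y : E, Continuous fun h : 𝓢(E, ℂ) => h y := fun y =>
    (show 𝓢(E, ℂ) →L[ℂ] ℂ from TemperedDistribution.delta y).continuous
  have hmeas : ∀ y, AEStronglyMeasurable (fun t => f t y) μ := fun y =>
    ((heval y).comp hf.continuous).aestronglyMeasurable
  have hbd : ∀ t, ∀ y, ‖fderiv ℝ (f t) y‖ ≤ SchwartzMap.seminorm ℂ 0 1 (f t) := fun t y => by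
    have h := SchwartzMap.norm_iteratedFDeriv_le_seminorm ℂ (f t) 1 y
    rwa [norm_iteratedFDeriv_one] at h
  have hint : Integrable (fun t => f t x) μ := by
    refine Integrable.mono' (hf.integrable 0 0) (hmeas x) (.of_forall fun t => ?_)
    exact SchwartzMap.norm_le_seminorm ℂ (f t) x
  have hcont : Continuous fun t => fderiv ℝ (f t) x :=
    (ContinuousEvalConst.continuous_eval_const x).comp
      ((SchwartzMap.toBoundedContinuousFunctionCLM ℂ E (E →L[ℝ] ℂ)).continuous.comp
        ((SchwartzMap.fderivCLM ℂ E ℂ).continuous.comp hf.continuous))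
  have key := hasFDerivAt_integral_of_dominated_of_fderiv_le (μ := μ) (F := fun y t => f t y)
    (F' := fun y t => fderiv ℝ (f t) y) (x₀ := x) (s := Set.univ)
    (bound := fun t => SchwartzMap.seminorm ℂ 0 1 (f t)) Filter.univ_mem (.of_forall hmeas) hint
    hcont.aestronglyMeasurable (.of_forall fun t y _ => hbd t y) (hf.integrable 0 1)
    (.of_forall fun t y _ => (f t).hasFDerivAt y)
  have hg' : (g : E → ℂ) = fun y => ∫ t, f t y ∂μ := funext hg
  rw [SchwartzMap.lineDerivOp_apply_eq_fderiv, hg', key.fderiv,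
    ContinuousLinearMap.integral_apply]
  · rfl
  · exact Integrable.mono' (hf.integrable 0 1) hcont.aestronglyMeasurable
      (.of_forall fun t => hbd t x)

theorem IsIntegrableFamily.iteratedLineDerivOp_apply_eq_integral {l : ℕ} (m : Fin l → E)
    {f : T → 𝓢(E, ℂ)} (hf : IsIntegrableFamily μ f) {g : 𝓢(E, ℂ)}
    (hg : ∀ x, g x = ∫ t, f t x ∂μ) (x : E) :
    (∂^{m} g) x = ∫ t, (∂^{m} (f t)) x ∂μ := by
  induction l generalizing f g x with
  | zero => simpa using hg x
  | succ l ih =>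
    simp only [LineDeriv.iteratedLineDerivOp_succ_right]
    exact ih (Fin.init m) (hf.comp_clm (LineDeriv.lineDerivOpCLM ℂ 𝓢(E, ℂ) (m (Fin.last l))))
      (hf.lineDerivOp_apply_eq_integral hg _) x

/-- A continuous functional on the Schwartz space factors through a continuous functional on a
product of finitely many spaces of bounded continuous functions. -/
theorem exists_factor_weightedDeriv (u : 𝓢(E, ℂ) →L[ℂ] ℂ) :
    ∃ (s : Finset (ℕ × ℕ)) (U : (Π i : s, BoundedForms E i.1.2) →L[ℂ] ℂ),
      ∀ f, u f = U fun i => weightedDeriv i.1.1 i.1.2 f := by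
  obtain ⟨s, C, hC, h⟩ := exists_le_sum_seminorm ((normSeminorm ℂ ℂ).comp u.toLinearMap)
    (continuous_norm.comp u.continuous)
  let J : 𝓢(E, ℂ) →ₗ[ℂ] (Π i : s, BoundedForms E i.1.2) :=
    LinearMap.pi fun i => (weightedDeriv i.1.1 i.1.2).toLinearMap
  have hb : ∀ f, ‖u f‖ ≤ C * s.card * ‖J f‖ := fun f => by
    refine (h f).trans ?_
    rw [mul_assoc, ← nsmul_eq_mul]
    gcongr
    refine Finset.sum_le_card_nsmul _ _ _ fun i hi => ?_
    exact (seminorm_le_norm_weightedDeriv i.1 i.2 f).trans (norm_le_pi_norm (J f) ⟨i, hi⟩)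
  have hker : LinearMap.ker J ≤ LinearMap.ker u.toLinearMap := fun f hf => by
    have h0 : ‖J f‖ = 0 := by rw [LinearMap.mem_ker.1 hf]; exact norm_zero
    have := hb f
    rw [h0, mul_zero] at this
    exact norm_le_zero_iff.1 this
  let U₀ : LinearMap.range J →ₗ[ℂ] ℂ :=
    ((LinearMap.ker J).liftQ u.toLinearMap hker).comp J.quotKerEquivRange.symm.toLinearMap
  have hU₀ : ∀ f, U₀ ⟨J f, LinearMap.mem_range_self J f⟩ = u f := fun f => by
    have : J.quotKerEquivRange.symm ⟨J f, LinearMap.mem_range_self J f⟩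
        = (LinearMap.ker J).mkQ f := J.quotKerEquivRange_symm_apply_image f _
    simp only [U₀, LinearMap.comp_apply, LinearEquiv.coe_coe, this]
    simp
  obtain ⟨U, hU, -⟩ := exists_extension_norm_eq (LinearMap.range J)
    (U₀.mkContinuous (C * s.card) (by
      rintro ⟨_, f, rfl⟩
      rw [hU₀ f]
      exact hb f))
  refine ⟨s, U, fun f => ?_⟩
  have := hU ⟨J f, LinearMap.mem_range_self J f⟩
  rw [LinearMap.mkContinuous_apply, hU₀] at this
  exact this.symm

/-- A tempered distribution may be applied under the integral sign to an integrable family of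
Schwartz functions, as soon as the pointwise integral is itself a Schwartz function. The proof
factors the distribution through a Banach space and computes a Bochner integral there. -/
theorem IsIntegrableFamily.apply_eq_integral {f : T → 𝓢(E, ℂ)} (hf : IsIntegrableFamily μ f)
    {g : 𝓢(E, ℂ)} (hg : ∀ x, g x = ∫ t, f t x ∂μ) (u : 𝓢(E, ℂ) →L[ℂ] ℂ) :
    u g = ∫ t, u (f t) ∂μ := by
  obtain ⟨s, U, hU⟩ := exists_factor_weightedDeriv u
  simp only [hU]
  have hcont : ∀ i : ℕ × ℕ, Continuous fun t => weightedDeriv i.1 i.2 (f t) := fun i =>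
    (weightedDeriv i.1 i.2).continuous.comp hf.continuous
  have hint : ∀ i : ℕ × ℕ, Integrable (fun t => weightedDeriv i.1 i.2 (f t)) μ := fun i =>
    Integrable.mono' (hf.integrable i.1 i.2) (hcont i).aestronglyMeasurable
      (.of_forall fun t => norm_weightedDeriv_le i.1 i.2 (f t))
  rw [U.integral_comp_comm (Integrable.of_eval fun i => hint i.1)]
  congr 1
  funext i
  rw [eval_integral fun i : s => hint i.1]
  refine BoundedForms.ext fun x m => ?_
  rw [← (evalForm x m).integral_comp_comm (hint i.1)]
  simp only [evalForm_weightedDeriv]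
  rw [integral_smul]
  congr 1
  simp only [← SchwartzMap.iteratedLineDerivOp_eq_iteratedFDeriv]
  exact hf.iteratedLineDerivOp_apply_eq_integral m hg x

end Pettis

/-! ### Translations and products of Schwartz functions -/

section Translation

open Filter Topology

variable {E : Type*} [NormedAddCommGroup E] [NormedSpace ℝ E]

/-- Translation by `y` on the Schwartz space. -/
abbrev translate (y : E) : 𝓢(E, ℂ) →L[ℂ] 𝓢(E, ℂ) := SchwartzMap.compSubConstCLM ℂ y

/-- Multiplication by a Schwartz function on the Schwartz space. -/
abbrev mulSchwartz (φ : 𝓢(E, ℂ)) : 𝓢(E, ℂ) →L[ℂ] 𝓢(E, ℂ) := SchwartzMap.smulLeftCLM ℂ (φ : E → ℂ)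

theorem mulSchwartz_apply (φ f : 𝓢(E, ℂ)) (x : E) : mulSchwartz φ f x = φ x * f x := by
  rw [mulSchwartz, SchwartzMap.smulLeftCLM_apply_apply φ.hasTemperateGrowth, smul_eq_mul]

omit [NormedSpace ℝ E] in
theorem one_add_norm_le_mul (x y : E) : 1 + ‖x‖ ≤ (1 + ‖y‖) * (1 + ‖x - y‖) := by
  have h := norm_le_norm_add_norm_sub' x y
  nlinarith [mul_nonneg (norm_nonneg y) (norm_nonneg (x - y))]

theorem iteratedFDeriv_translate (l : ℕ) (y : E) (f : 𝓢(E, ℂ)) (x : E) :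
    iteratedFDeriv ℝ l (translate y f) x = iteratedFDeriv ℝ l f (x - y) := by
  have : (translate y f : E → ℂ) = fun z => f (z - y) := by
    funext z; simp
  rw [this, iteratedFDeriv_comp_sub]

/-- The supremum of the Schwartz seminorms with indices up to `(k, l)`. -/
abbrev supSeminorm (k l : ℕ) : Seminorm ℂ 𝓢(E, ℂ) :=
  (Finset.Iic (k, l)).sup fun m => SchwartzMap.seminorm ℂ m.1 m.2

theorem one_add_pow_mul_le (f : 𝓢(E, ℂ)) {k l l' : ℕ} (hl : l' ≤ l) (x : E) :
    (1 + ‖x‖) ^ k * ‖iteratedFDeriv ℝ l' f x‖ ≤ 2 ^ k * supSeminorm k l f :=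
  SchwartzMap.one_add_le_sup_seminorm_apply (𝕜 := ℂ) (m := (k, l)) le_rfl hl f x

theorem seminorm_translate_le (k l : ℕ) (y : E) (f : 𝓢(E, ℂ)) :
    SchwartzMap.seminorm ℂ k l (translate y f)
      ≤ (1 + ‖y‖) ^ k * (2 ^ k * supSeminorm k l f) := by
  refine SchwartzMap.seminorm_le_bound ℂ k l _ (by positivity) fun x => ?_
  rw [iteratedFDeriv_translate]
  calc ‖x‖ ^ k * ‖iteratedFDeriv ℝ l f (x - y)‖
      ≤ ((1 + ‖y‖) * (1 + ‖x - y‖)) ^ k * ‖iteratedFDeriv ℝ l f (x - y)‖ := by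
        gcongr
        exact (by linarith : ‖x‖ ≤ 1 + ‖x‖).trans (one_add_norm_le_mul x y)
    _ = (1 + ‖y‖) ^ k * ((1 + ‖x - y‖) ^ k * ‖iteratedFDeriv ℝ l f (x - y)‖) := by
        rw [mul_pow]; ring
    _ ≤ _ := by
        exact mul_le_mul_of_nonneg_left (one_add_pow_mul_le f le_rfl _) (by positivity)

theorem continuous_supSeminorm (k l : ℕ) :
    Continuous (supSeminorm k l : Seminorm ℂ 𝓢(E, ℂ)) := by
  refine Seminorm.continuous_finsetSup fun i _ => ?_
  exact continuous_seminorm i.1 i.2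

/-- By the mean value inequality a Schwartz function is Lipschitz continuous under small
translations, in every Schwartz seminorm. -/
theorem seminorm_translate_sub_le (k l : ℕ) (f : 𝓢(E, ℂ)) {y : E} (hy : ‖y‖ ≤ 1) :
    SchwartzMap.seminorm ℂ k l (translate y f - f)
      ≤ 2 ^ k * (2 ^ k * supSeminorm k (l + 1) f) * ‖y‖ := by
  refine SchwartzMap.seminorm_le_bound ℂ k l _ (by positivity) fun x => ?_
  have h1 : iteratedFDeriv ℝ l (translate y f - f : 𝓢(E, ℂ)) x
      = iteratedFDeriv ℝ l f (x - y) - iteratedFDeriv ℝ l f x := by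
    have := iteratedFDeriv_sub_apply (x := x) ((translate y f).smooth l).contDiffAt
      (f.smooth l).contDiffAt
    rw [iteratedFDeriv_translate] at this
    simpa using this
  have hd : Differentiable ℝ (iteratedFDeriv ℝ l f) :=
    (f.smooth ⊤).differentiable_iteratedFDeriv (by exact_mod_cast ENat.natCast_lt_top l)
  have h2 := (convex_closedBall x 1).norm_image_sub_le_of_norm_fderiv_le (𝕜 := ℝ)
    (f := fun z => ‖x‖ ^ k • iteratedFDeriv ℝ l f z) (x := x) (y := x - y)
    (C := 2 ^ k * (2 ^ k * supSeminorm k (l + 1) f))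
    (fun z _ => (hd z).fun_const_smul _) (fun z hz => ?_) (by simp) (by simpa using hy)
  · rw [h1]
    rw [← smul_sub, norm_smul, norm_pow, norm_norm] at h2
    simpa using h2
  · rw [fderiv_fun_const_smul (hd z), norm_smul, norm_pow, norm_norm, norm_fderiv_iteratedFDeriv]
    have hxz : ‖x‖ ≤ 2 * (1 + ‖z‖) := by
      have h3 := norm_le_norm_add_norm_sub' x z
      rw [Metric.mem_closedBall, dist_comm, dist_eq_norm] at hz
      linarith [norm_nonneg z]
    calc ‖x‖ ^ k * ‖iteratedFDeriv ℝ (l + 1) f z‖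
        ≤ (2 * (1 + ‖z‖)) ^ k * ‖iteratedFDeriv ℝ (l + 1) f z‖ := by gcongr
      _ = 2 ^ k * ((1 + ‖z‖) ^ k * ‖iteratedFDeriv ℝ (l + 1) f z‖) := by rw [mul_pow]; ring
      _ ≤ _ := mul_le_mul_of_nonneg_left (one_add_pow_mul_le f le_rfl z) (by positivity)

/-- Translation acts jointly continuously on the Schwartz space. -/
theorem continuous_translate : Continuous fun q : E × 𝓢(E, ℂ) => translate q.1 q.2 := by
  have h0 : ∀ f : 𝓢(E, ℂ), Tendsto (fun y : E => translate y f - f) (𝓝 0) (𝓝 0) := fun f => by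
    refine ((schwartz_withSeminorms ℂ E ℂ).tendsto_nhds _ _).2 fun i ε hε => ?_
    have hlim : Tendsto (fun y : E => 2 ^ i.1 * (2 ^ i.1 * supSeminorm i.1 (i.2 + 1) f) * ‖y‖)
        (𝓝 0) (𝓝 0) :=
      Continuous.tendsto' (by fun_prop) _ _ (by simp)
    filter_upwards [hlim.eventually (gt_mem_nhds hε), Metric.closedBall_mem_nhds (0 : E) one_pos]
      with y hy hy1
    rw [sub_zero]
    exact (seminorm_translate_sub_le i.1 i.2 f (by simpa using hy1)).trans_lt hy
  refine continuous_iff_continuousAt.2 fun ⟨y₀, f₀⟩ => ?_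
  have hsplit : ∀ q : E × 𝓢(E, ℂ), translate q.1 q.2
      = translate q.1 (q.2 - f₀) + translate y₀ (translate (q.1 - y₀) f₀ - f₀)
        + translate y₀ f₀ := fun q => by
    ext x
    simp
  have hA : Tendsto (fun q : E × 𝓢(E, ℂ) => translate q.1 (q.2 - f₀)) (𝓝 (y₀, f₀)) (𝓝 0) := by
    refine ((schwartz_withSeminorms ℂ E ℂ).tendsto_nhds _ _).2 fun i ε hε => ?_
    have hcont : Continuous fun q : E × 𝓢(E, ℂ) =>
        (1 + ‖q.1‖) ^ i.1 * (2 ^ i.1 * supSeminorm i.1 i.2 (q.2 - f₀)) :=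
      ((continuous_const.add continuous_fst.norm).pow _).mul
        (continuous_const.mul ((continuous_supSeminorm i.1 i.2).comp
          (continuous_snd.sub continuous_const)))
    have hlim := hcont.tendsto (y₀, f₀)
    simp only [sub_self, map_zero, mul_zero] at hlim
    filter_upwards [hlim.eventually (gt_mem_nhds hε)] with q hq
    rw [sub_zero]
    exact (seminorm_translate_le i.1 i.2 q.1 _).trans_lt hq
  have hB : Tendsto (fun q : E × 𝓢(E, ℂ) => translate y₀ (translate (q.1 - y₀) f₀ - f₀))
      (𝓝 (y₀, f₀)) (𝓝 0) := by
    have h1 : Tendsto (fun q : E × 𝓢(E, ℂ) => q.1 - y₀) (𝓝 (y₀, f₀)) (𝓝 0) :=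
      Continuous.tendsto' (by fun_prop) _ _ (by simp)
    exact ((translate y₀).continuous.tendsto' 0 0 (map_zero _)).comp ((h0 f₀).comp h1)
  have := (hA.add hB).add_const (translate y₀ f₀)
  simp only [zero_add] at this
  exact this.congr fun q => (hsplit q).symm

/-- The product of two Schwartz functions decays rapidly, in every Schwartz seminorm, when one of
them is translated. -/
theorem exists_seminorm_mul_translate_le (φ g : 𝓢(E, ℂ)) (k l N : ℕ) :
    ∃ C : ℝ, 0 ≤ C ∧ ∀ η : E,
      (1 + ‖η‖) ^ N * SchwartzMap.seminorm ℂ k l (mulSchwartz φ (translate η g)) ≤ C := by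
  set A := 2 ^ (N + k) * supSeminorm (N + k) l φ
  set B := 2 ^ N * supSeminorm N l g
  have hA : 0 ≤ A := by positivity
  have hB : 0 ≤ B := by positivity
  refine ⟨2 ^ l * (A * B), by positivity, fun η => ?_⟩
  rw [← le_div_iff₀' (by positivity)]
  refine SchwartzMap.seminorm_le_bound ℂ k l _ (by positivity) fun x => ?_
  rw [le_div_iff₀' (by positivity)]
  have hfun : (mulSchwartz φ (translate η g) : E → ℂ) = fun z => φ z * translate η g z :=
    funext fun z => mulSchwartz_apply _ _ _
  have h1 := norm_iteratedFDeriv_mul_le (n := l) (φ.smooth l)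
    ((translate η g).smooth l) x le_rfl
  have hη : 1 + ‖η‖ ≤ (1 + ‖x‖) * (1 + ‖x - η‖) := by
    rw [← norm_sub_rev η x]; exact one_add_norm_le_mul η x
  calc (1 + ‖η‖) ^ N * (‖x‖ ^ k * ‖iteratedFDeriv ℝ l (mulSchwartz φ (translate η g)) x‖)
      ≤ ((1 + ‖x‖) * (1 + ‖x - η‖)) ^ N * ((1 + ‖x‖) ^ k *
          ∑ i ∈ Finset.range (l + 1), (l.choose i : ℝ) * ‖iteratedFDeriv ℝ i φ x‖ *
            ‖iteratedFDeriv ℝ (l - i) (translate η g) x‖) := by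
        rw [hfun]
        gcongr
        linarith
    _ = ∑ i ∈ Finset.range (l + 1), (l.choose i : ℝ) *
          (((1 + ‖x‖) ^ (N + k) * ‖iteratedFDeriv ℝ i φ x‖) *
            ((1 + ‖x - η‖) ^ N * ‖iteratedFDeriv ℝ (l - i) g (x - η)‖)) := by
        simp only [iteratedFDeriv_translate, Finset.mul_sum]
        refine Finset.sum_congr rfl fun i _ => ?_
        rw [mul_pow, pow_add]; ring
    _ ≤ ∑ i ∈ Finset.range (l + 1), (l.choose i : ℝ) * (A * B) := by
        refine Finset.sum_le_sum fun i hi => ?_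
        have hi' : i ≤ l := Nat.lt_succ_iff.1 (Finset.mem_range.1 hi)
        gcongr
        · exact one_add_pow_mul_le φ hi' x
        · exact one_add_pow_mul_le g (Nat.sub_le l i) _
    _ = 2 ^ l * (A * B) := by
        rw [← Finset.sum_mul]
        congr 1
        exact_mod_cast Nat.sum_range_choose l

end Translation

/-! ### The Fourier transform of Schwartz functions -/

section Fourier

variable {n : ℕ}

/-- The Euclidean space `ℝⁿ`. -/
abbrev Euc (n : ℕ) : Type := EuclideanSpace ℝ (Fin n)

/-- The character `x ↦ e^{-i⟨x, ξ⟩}`. -/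
def character (ξ x : Euc n) : ℂ := Complex.exp (-Complex.I * ((inner ℝ x ξ : ℝ) : ℂ))

theorem character_comm (ξ x : Euc n) : character ξ x = character x ξ := by
  rw [character, character, real_inner_comm]

theorem norm_character (ξ x : Euc n) : ‖character ξ x‖ = 1 := by
  rw [character, Complex.norm_exp]; simp

theorem continuous_character : Continuous fun q : Euc n × Euc n => character q.1 q.2 := by
  unfold character
  fun_prop

theorem character_add (ξ x y : Euc n) : character ξ (x + y) = character ξ x * character ξ y := by
  rw [character, character, character, ← Complex.exp_add, inner_add_left]
  push_cast; ring_nf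

theorem character_neg (ξ x : Euc n) : character ξ (-x) = character (-ξ) x := by
  rw [character, character, inner_neg_left, inner_neg_right]

theorem character_sub (ξ x y : Euc n) : character ξ (x - y) = character ξ x * character (-ξ) y := by
  rw [sub_eq_add_neg, character_add, character_neg]

theorem character_add_left (ξ η x : Euc n) :
    character (ξ + η) x = character ξ x * character η x := by
  rw [character_comm, character_add, character_comm x, character_comm x]

/-- Multiplication by the character `x ↦ e^{-i⟨x, ξ⟩}` on the Schwartz space. -/
def modulate (ξ : Euc n) : 𝓢(Euc n, ℂ) →L[ℂ] 𝓢(Euc n, ℂ) :=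
  SchwartzMap.smulLeftCLM ℂ (character ξ)

theorem modulate_apply (ξ : Euc n) (f : 𝓢(Euc n, ℂ)) (x : Euc n) :
    modulate ξ f x = character ξ x * f x := by
  have h : (character ξ).HasTemperateGrowth := hasTemperateGrowth_character ξ
  rw [modulate, SchwartzMap.smulLeftCLM_apply_apply h, smul_eq_mul]

theorem modTranslate_eq (χ : 𝓢(Euc n, ℂ)) (y ξ : Euc n) :
    modTranslate χ y ξ = modulate ξ (translate y χ) := rfl

theorem schwartzHat_apply' (f : 𝓢(Euc n, ℂ)) (ξ : Euc n) :
    schwartzHat n f ξ = ∫ x, character ξ x * f x := schwartzHat_apply f ξ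

/-- The inverse of the Fourier transform `schwartzHat`. -/
def schwartzUnhat (n : ℕ) : 𝓢(Euc n, ℂ) →L[ℂ] 𝓢(Euc n, ℂ) :=
  (FourierTransform.fourierInvCLM ℂ 𝓢(Euc n, ℂ)).comp
    (SchwartzMap.compCLMOfContinuousLinearEquiv ℂ (dilation n).symm)

theorem schwartzHat_schwartzUnhat (f : 𝓢(Euc n, ℂ)) : schwartzHat n (schwartzUnhat n f) = f := by
  ext x
  simp [schwartzHat, schwartzUnhat]

theorem schwartzUnhat_schwartzHat (f : 𝓢(Euc n, ℂ)) : schwartzUnhat n (schwartzHat n f) = f := by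
  have : SchwartzMap.compCLMOfContinuousLinearEquiv ℂ (dilation n).symm (schwartzHat n f)
      = 𝓕 f := by
    ext x
    simp [schwartzHat]
  rw [schwartzUnhat, ContinuousLinearMap.comp_apply, this]
  simp

/-- The constant `(2π)⁻ⁿ` of the Fourier inversion formula. -/
def inversionConst (n : ℕ) : ℝ := ((2 * Real.pi) ^ n)⁻¹

theorem schwartzUnhat_apply (f : 𝓢(Euc n, ℂ)) (η : Euc n) :
    schwartzUnhat n f η = inversionConst n * ∫ x, character (-η) x * f x := by
  have h1 : schwartzUnhat n f η
      = 𝓕⁻ (SchwartzMap.compCLMOfContinuousLinearEquiv ℂ (dilation n).symm f : Euc n → ℂ) η := by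
    rw [← SchwartzMap.fourierInv_coe]
    rfl
  have h2 : ∀ x : Euc n, (dilation n).symm x = (2 * Real.pi) • x := fun x => by
    rw [ContinuousLinearEquiv.symm_apply_eq]
    change x = (2 * Real.pi)⁻¹ • ((2 * Real.pi) • x)
    rw [inv_smul_smul₀ (by positivity)]
  have h3 := Measure.integral_comp_smul (volume : Measure (Euc n))
    (fun x => character (-η) x * f x) (2 * Real.pi)
  rw [h1, Real.fourierInv_eq']
  simp only [finrank_euclideanSpace, Fintype.card_fin] at h3
  rw [abs_of_pos (by positivity), Complex.real_smul] at h3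
  rw [inversionConst, ← h3]
  refine integral_congr_ae (.of_forall fun x => ?_)
  simp only [SchwartzMap.compCLMOfContinuousLinearEquiv_apply, Function.comp_apply, h2,
    smul_eq_mul, character, inner_smul_left, inner_neg_right]
  congr 2
  simp
  ring

theorem schwartzHat_translate (ξ : Euc n) (f : 𝓢(Euc n, ℂ)) :
    schwartzHat n (translate ξ f) = modulate ξ (schwartzHat n f) := by
  ext η
  rw [modulate_apply, schwartzHat_apply', schwartzHat_apply', ← integral_const_mul,
    ← integral_sub_right_eq_self (fun x => character ξ η * (character η x * f x)) ξ]
  refine integral_congr_ae (.of_forall fun x => ?_)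
  simp only [SchwartzMap.compSubConstCLM_apply]
  rw [character_comm ξ η, ← mul_assoc, ← character_add, add_sub_cancel]

theorem schwartzHat_modulate (ξ : Euc n) (f : 𝓢(Euc n, ℂ)) :
    schwartzHat n (modulate ξ f) = translate (-ξ) (schwartzHat n f) := by
  ext η
  rw [SchwartzMap.compSubConstCLM_apply, schwartzHat_apply', schwartzHat_apply']
  refine integral_congr_ae (.of_forall fun x => ?_)
  simp only [modulate_apply]
  rw [sub_neg_eq_add, character_add_left, mul_assoc]

theorem modulate_eq_schwartzHat (ξ : Euc n) (f : 𝓢(Euc n, ℂ)) :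
    modulate ξ f = schwartzHat n (translate ξ (schwartzUnhat n f)) := by
  rw [schwartzHat_translate, schwartzHat_schwartzUnhat]

theorem schwartzUnhat_modulate (ξ : Euc n) (f : 𝓢(Euc n, ℂ)) :
    schwartzUnhat n (modulate ξ f) = translate ξ (schwartzUnhat n f) := by
  rw [modulate_eq_schwartzHat, schwartzUnhat_schwartzHat]

theorem schwartzUnhat_translate (y : Euc n) (f : 𝓢(Euc n, ℂ)) :
    schwartzUnhat n (translate y f) = modulate (-y) (schwartzUnhat n f) := by
  have h := schwartzHat_modulate (-y) (schwartzUnhat n f)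
  rw [schwartzHat_schwartzUnhat, neg_neg] at h
  rw [← h, schwartzUnhat_schwartzHat]

/-- The product formula for the Fourier transform, one of the factors being given as an inverse
Fourier transform: it turns products into convolutions. -/
theorem schwartzHat_mul_schwartzUnhat (f h : 𝓢(Euc n, ℂ)) (z : Euc n) :
    schwartzHat n (mulSchwartz f (schwartzUnhat n h)) z
      = inversionConst n * ∫ x, h x * schwartzHat n f (z - x) := by
  have hint : Integrable (Function.uncurry fun η x : Euc n =>
      character (z - x) η * (f η * h x)) (volume.prod volume) := by
    refine Integrable.bdd_mul (c := 1) (f.integrable.mul_prod h.integrable)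
      (Continuous.aestronglyMeasurable ?_) (.of_forall fun q => (norm_character _ _).le)
    exact continuous_character.comp
      (by fun_prop : Continuous fun q : Euc n × Euc n => (z - q.2, q.1))
  rw [schwartzHat_apply']
  calc ∫ η, character z η * mulSchwartz f (schwartzUnhat n h) η
      = inversionConst n * ∫ η, ∫ x, character (z - x) η * (f η * h x) := by
        rw [← integral_const_mul]
        refine integral_congr_ae (.of_forall fun η => ?_)
        simp only [mulSchwartz_apply, schwartzUnhat_apply]
        have h1 : character z η * (f η * (inversionConst n * ∫ x, character (-η) x * h x))
            = inversionConst n * ∫ x, character z η * f η * (character (-η) x * h x) := by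
          rw [integral_const_mul]; ring
        rw [h1]
        refine congrArg _ (integral_congr_ae (.of_forall fun x => ?_))
        simp only
        rw [character_comm (z - x), character_sub, character_comm z, character_comm (-η)]
        ring
    _ = _ := by
        rw [integral_integral_swap hint]
        congr 1
        refine integral_congr_ae (.of_forall fun x => ?_)
        simp only
        rw [schwartzHat_apply', ← integral_const_mul]
        refine integral_congr_ae (.of_forall fun η => ?_)
        simp only
        ring

theorem continuous_modulate :
    Continuous fun q : Euc n × 𝓢(Euc n, ℂ) => modulate q.1 q.2 := by
  simp only [modulate_eq_schwartzHat]
  exact (schwartzHat n).continuous.comp (continuous_translate.comp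
    (continuous_fst.prodMk ((schwartzUnhat n).continuous.comp continuous_snd)))

theorem continuous_modTranslate (χ : 𝓢(Euc n, ℂ)) :
    Continuous fun q : Euc n × Euc n => modTranslate χ q.1 q.2 := by
  have h1 : Continuous fun y : Euc n => translate y χ :=
    continuous_translate.comp (Continuous.prodMk continuous_id continuous_const)
  have h2 : Continuous fun q : Euc n × Euc n => (q.2, translate q.1 χ) :=
    continuous_snd.prodMk (h1.comp continuous_fst)
  have h3 := (continuous_modulate (n := n)).comp h2
  refine h3.congr fun q => ?_
  rw [modTranslate_eq, Function.comp_apply]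

theorem continuous_localFourier (u : 𝓢'(Euc n, ℂ)) (χ : 𝓢(Euc n, ℂ)) :
    Continuous fun q : Euc n × Euc n => localFourier u χ q.1 q.2 :=
  u.continuous.comp (continuous_modTranslate χ)

/-- Every continuous seminorm of a translate grows at most polynomially. -/
theorem exists_seminorm_translate_le (q : Seminorm ℂ 𝓢(Euc n, ℂ)) (hq : Continuous q) :
    ∃ (q' : Seminorm ℂ 𝓢(Euc n, ℂ)) (N : ℕ), Continuous q' ∧
      ∀ y f, q (translate y f) ≤ (1 + ‖y‖) ^ N * q' f := by
  obtain ⟨s, C, hC, h⟩ := exists_le_sum_seminorm q hq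
  let N := s.sup Prod.fst
  let q' : Seminorm ℂ 𝓢(Euc n, ℂ) :=
    C.toNNReal • ∑ i ∈ s, (2 ^ i.1 : ℝ≥0) • supSeminorm i.1 i.2
  have hq' : ∀ f, q' f = C * ∑ i ∈ s, 2 ^ i.1 * supSeminorm i.1 i.2 f := fun f => by
    simp only [q', smul_apply, sum_apply, NNReal.smul_def, smul_eq_mul, Real.coe_toNNReal _ hC]
    rfl
  refine ⟨q', N, ?_, fun y f => ?_⟩
  · rw [show (q' : 𝓢(Euc n, ℂ) → ℝ) = fun f => C * ∑ i ∈ s, 2 ^ i.1 * supSeminorm i.1 i.2 f from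
      funext hq']
    exact continuous_const.mul (continuous_finsetSum _ fun i _ =>
      continuous_const.mul (continuous_supSeminorm i.1 i.2))
  · refine (h _).trans ?_
    rw [hq', mul_left_comm]
    refine mul_le_mul_of_nonneg_left ?_ hC
    rw [Finset.mul_sum]
    refine Finset.sum_le_sum fun i hi => ?_
    refine (seminorm_translate_le i.1 i.2 y f).trans ?_
    have : i.1 ≤ N := Finset.le_sup (f := Prod.fst) hi
    refine mul_le_mul_of_nonneg_right (pow_le_pow_right₀ ?_ this) (by positivity)
    linarith [norm_nonneg y]

/-- The Schwartz seminorms of the time-frequency shifts of a Schwartz function grow at most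
polynomially. -/
theorem exists_seminorm_modTranslate_le (χ : 𝓢(Euc n, ℂ)) (k l : ℕ) :
    ∃ (C : ℝ) (N : ℕ), 0 ≤ C ∧ ∀ y ξ,
      SchwartzMap.seminorm ℂ k l (modTranslate χ y ξ)
        ≤ C * ((1 + ‖y‖) ^ N * (1 + ‖ξ‖) ^ N) := by
  let q₀ : Seminorm ℂ 𝓢(Euc n, ℂ) := (SchwartzMap.seminorm ℂ k l).comp (schwartzHat n).toLinearMap
  obtain ⟨q₁, N₁, hq₁, h₁⟩ := exists_seminorm_translate_le q₀
    ((continuous_seminorm k l).comp (schwartzHat n).continuous)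
  let q₁' : Seminorm ℂ 𝓢(Euc n, ℂ) := q₁.comp (schwartzUnhat n).toLinearMap
  obtain ⟨q₂, N₂, hq₂, h₂⟩ := exists_seminorm_translate_le q₁'
    (hq₁.comp (schwartzUnhat n).continuous)
  refine ⟨q₂ χ, max N₁ N₂, apply_nonneg _ _, fun y ξ => ?_⟩
  rw [modTranslate_eq, modulate_eq_schwartzHat]
  have h3 : q₁ (schwartzUnhat n (translate y χ)) ≤ (1 + ‖y‖) ^ N₂ * q₂ χ := by
    exact h₂ y χ
  calc _ ≤ (1 + ‖ξ‖) ^ N₁ * q₁ (schwartzUnhat n (translate y χ)) := h₁ ξ _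
    _ ≤ (1 + ‖ξ‖) ^ N₁ * ((1 + ‖y‖) ^ N₂ * q₂ χ) := mul_le_mul_of_nonneg_left h3 (by positivity)
    _ = q₂ χ * ((1 + ‖y‖) ^ N₂ * (1 + ‖ξ‖) ^ N₁) := by ring
    _ ≤ _ := by
        have hy : 1 ≤ 1 + ‖y‖ := by linarith [norm_nonneg y]
        have hξ : 1 ≤ 1 + ‖ξ‖ := by linarith [norm_nonneg ξ]
        exact mul_le_mul_of_nonneg_left (mul_le_mul (pow_le_pow_right₀ hy (le_max_right _ _))
          (pow_le_pow_right₀ hξ (le_max_left _ _)) (by positivity) (by positivity))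
          (apply_nonneg _ _)

end Fourier

/-! ### Minkowski's integral inequality -/

section Minkowski

variable {n : ℕ}

/-- The `L^p` norm (for `p = ∞`: the supremum) of a function with values in `[0, ∞]`. -/
def lpSupNorm (p : ℝ≥0∞) (f : Euc n → ℝ≥0∞) : ℝ≥0∞ :=
  if p = ∞ then ⨆ y, f y else (∫⁻ y, f y ^ p.toReal) ^ (1 / p.toReal)

theorem windowFun_eq_lpSupNorm (p : ℝ≥0∞) (χ : 𝓢(Euc n, ℂ)) (u : 𝓢'(Euc n, ℂ)) (ξ : Euc n) :
    windowFun p χ u ξ = lpSupNorm p fun y => ‖localFourier u χ y ξ‖ₑ := rfl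

theorem one_le_toReal {p : ℝ≥0∞} (hp : 1 ≤ p) (hp' : p ≠ ∞) : 1 ≤ p.toReal := by
  rwa [← ENNReal.toReal_one, ENNReal.toReal_le_toReal ENNReal.one_ne_top hp']

theorem lpSupNorm_mono (p : ℝ≥0∞) {f g : Euc n → ℝ≥0∞} (h : ∀ y, f y ≤ g y) :
    lpSupNorm p f ≤ lpSupNorm p g := by
  unfold lpSupNorm
  split_ifs
  · exact iSup_mono h
  · gcongr with y
    exact h y

theorem lpSupNorm_const_mul {p : ℝ≥0∞} (hp : 1 ≤ p) (c : ℝ≥0∞) {f : Euc n → ℝ≥0∞}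
    (hf : Measurable f) : lpSupNorm p (fun y => c * f y) = c * lpSupNorm p f := by
  unfold lpSupNorm
  split_ifs with h
  · rw [ENNReal.mul_iSup]
  · have hr := one_le_toReal hp h
    have hr0 : 0 < p.toReal := by linarith
    simp only [ENNReal.mul_rpow_of_nonneg _ _ hr0.le]
    rw [lintegral_const_mul _ (hf.pow_const _), ENNReal.mul_rpow_of_nonneg _ _ (by positivity),
      ← ENNReal.rpow_mul, mul_one_div_cancel hr0.ne', ENNReal.rpow_one]

theorem lpSupNorm_comp_add_right (p : ℝ≥0∞) (f : Euc n → ℝ≥0∞) (z : Euc n) :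
    lpSupNorm p (fun y => f (y + z)) = lpSupNorm p f := by
  unfold lpSupNorm
  split_ifs
  · exact (Equiv.addRight z).iSup_comp (g := f)
  · rw [lintegral_add_right_eq_self (fun y => f y ^ p.toReal) z]

theorem lpSupNorm_enorm {p : ℝ≥0∞} (hp : 1 ≤ p) (hp' : p ≠ ∞) (f : Euc n → ℂ) :
    lpSupNorm p (fun y => ‖f y‖ₑ) = eLpNorm f p volume := by
  rw [lpSupNorm, if_neg hp', eLpNorm_eq_lintegral_rpow_enorm_toReal (zero_lt_one.trans_le hp).ne' hp']

theorem eLpNorm_le_lpSupNorm {p : ℝ≥0∞} (hp : 1 ≤ p) (f : Euc n → ℂ) :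
    eLpNorm f p volume ≤ lpSupNorm p (fun y => ‖f y‖ₑ) := by
  by_cases hp' : p = ∞
  · subst hp'
    rw [lpSupNorm, if_pos rfl, eLpNorm_exponent_top]
    exact essSup_le_of_ae_le _ (.of_forall fun y => le_iSup (fun y => ‖f y‖ₑ) y)
  · exact (lpSupNorm_enorm hp hp' f).ge

variable {T : Type*} [MeasurableSpace T] {μ : Measure T} [SFinite μ]

/-- Minkowski's integral inequality for a finite exponent `r > 1`: with `N t` the `L^r` norm of
`F · t`, Hölder's inequality is applied to `F y t = (F y t * N t ^ (-1/s)) * N t ^ (1/s)`. -/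
theorem lintegral_lintegral_rpow_le {r s : ℝ} (hrs : r.HolderConjugate s)
    {F : Euc n → T → ℝ≥0∞} (hF : Measurable (Function.uncurry F)) :
    ∫⁻ y, (∫⁻ t, F y t ∂μ) ^ r ≤ (∫⁻ t, (∫⁻ y, F y t ^ r) ^ (1 / r) ∂μ) ^ r := by
  have hr := hrs.lt
  have hr0 : 0 < r := by linarith
  have hs0 : 0 < s := hrs.symm.pos
  set N : T → ℝ≥0∞ := fun t => (∫⁻ y, F y t ^ r) ^ (1 / r)
  have hFt : Measurable fun q : T × Euc n => F q.2 q.1 := hF.comp measurable_swap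
  have hN : Measurable N := ((hFt.pow_const r).lintegral_prod_right').pow_const _
  have hNr : ∀ t, N t ^ r = ∫⁻ y, F y t ^ r := fun t => by
    rw [← ENNReal.rpow_mul, one_div_mul_cancel hr0.ne', ENNReal.rpow_one]
  by_cases htop : ∫⁻ t, N t ∂μ = ∞
  · rw [htop, ENNReal.top_rpow_of_pos hr0]; exact le_top
  have hfin : ∀ᵐ t ∂μ, N t < ∞ := ae_lt_top hN htop
  have hzero : ∀ᵐ t ∂μ, ∀ᵐ y : Euc n, N t = 0 → F y t = 0 := .of_forall fun t => by
    by_cases h0 : N t = 0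
    · have h1 : ∫⁻ y, F y t ^ r = 0 := by rw [← hNr, h0, ENNReal.zero_rpow_of_pos hr0]
      have h2 := (lintegral_eq_zero_iff
        ((hFt.comp measurable_prodMk_left).pow_const r : Measurable fun y => F y t ^ r)).1 h1
      filter_upwards [h2] with y hy _
      exact (ENNReal.rpow_eq_zero_iff_of_pos hr0).1 hy
    · exact .of_forall fun y h => absurd h h0
  have hzero' : ∀ᵐ y : Euc n, ∀ᵐ t ∂μ, N t = 0 → F y t = 0 := by
    refine (Measure.ae_ae_comm ?_).1 hzero
    have hA : MeasurableSet {q : T × Euc n | N q.1 = 0} :=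
      (hN.comp measurable_fst) (measurableSet_singleton 0)
    have hB : MeasurableSet {q : T × Euc n | F q.2 q.1 = 0} := hFt (measurableSet_singleton 0)
    have : {q : T × Euc n | N q.1 = 0 → F q.2 q.1 = 0} = {q | N q.1 = 0}ᶜ ∪ {q | F q.2 q.1 = 0} := by
      ext q; simp [imp_iff_not_or]
    exact this ▸ hA.compl.union hB
  have hpt : ∀ᵐ y : Euc n, (∫⁻ t, F y t ∂μ) ^ r
      ≤ (∫⁻ t, F y t ^ r * N t ^ (-(r / s)) ∂μ) * (∫⁻ t, N t ∂μ) ^ (r / s) := by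
    filter_upwards [hzero'] with y hy
    have hFy : Measurable (F y) := hF.comp measurable_prodMk_left
    have h1 : ∫⁻ t, F y t ∂μ = ∫⁻ t, ((fun t => F y t * N t ^ (-(1 / s))) * fun t => N t ^ (1 / s)) t ∂μ := by
      refine lintegral_congr_ae ?_
      filter_upwards [hy, hfin] with t ht ht'
      by_cases h0 : N t = 0
      · simp [ht h0]
      · simp only [Pi.mul_apply]
        rw [mul_assoc, ← ENNReal.rpow_add _ _ h0 ht'.ne, neg_add_cancel, ENNReal.rpow_zero, mul_one]
    have h2 := ENNReal.lintegral_mul_le_Lp_mul_Lq μ hrs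
      (f := fun t => F y t * N t ^ (-(1 / s))) (g := fun t => N t ^ (1 / s))
      (hFy.mul (hN.pow_const _)).aemeasurable (hN.pow_const _).aemeasurable
    rw [← h1] at h2
    refine (ENNReal.rpow_le_rpow h2 hr0.le).trans (le_of_eq ?_)
    rw [ENNReal.mul_rpow_of_nonneg _ _ hr0.le, ← ENNReal.rpow_mul, ← ENNReal.rpow_mul,
      one_div_mul_cancel hr0.ne', ENNReal.rpow_one]
    congr 1
    · refine lintegral_congr fun t => ?_
      rw [ENNReal.mul_rpow_of_nonneg _ _ hr0.le, ← ENNReal.rpow_mul]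
      congr 2; ring
    · congr 1
      · refine lintegral_congr fun t => ?_
        rw [← ENNReal.rpow_mul, one_div_mul_cancel hs0.ne', ENNReal.rpow_one]
      · ring
  have hsr : 1 + r / s = r := by
    have := hrs.sub_one_mul_conj
    field_simp; linarith
  calc ∫⁻ y, (∫⁻ t, F y t ∂μ) ^ r
      ≤ ∫⁻ y, (∫⁻ t, F y t ^ r * N t ^ (-(r / s)) ∂μ) * (∫⁻ t, N t ∂μ) ^ (r / s) :=
        lintegral_mono_ae hpt
    _ = (∫⁻ t, (∫⁻ y, F y t ^ r) * N t ^ (-(r / s)) ∂μ) * (∫⁻ t, N t ∂μ) ^ (r / s) := by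
        have hm : Measurable (Function.uncurry fun (y : Euc n) (t : T) =>
            F y t ^ r * N t ^ (-(r / s))) :=
          (hF.pow_const r).mul ((hN.comp measurable_snd).pow_const _)
        have hm' : Measurable fun y : Euc n => ∫⁻ t, F y t ^ r * N t ^ (-(r / s)) ∂μ :=
          hm.lintegral_prod_right'
        rw [lintegral_mul_const _ hm', lintegral_lintegral_swap hm.aemeasurable]
        congr 1
        refine lintegral_congr fun t => ?_
        have hFr : Measurable fun y => F y t ^ r := (hFt.comp measurable_prodMk_left).pow_const r
        rw [lintegral_mul_const _ hFr]
    _ ≤ (∫⁻ t, N t ∂μ) * (∫⁻ t, N t ∂μ) ^ (r / s) := by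
        gcongr with t
        rw [← hNr]
        by_cases h0 : N t = 0
        · rw [h0, ENNReal.zero_rpow_of_pos hr0, zero_mul]
        by_cases h1 : N t = ∞
        · rw [h1]; exact le_top
        rw [← ENNReal.rpow_add _ _ h0 h1, show r + -(r / s) = 1 by linarith, ENNReal.rpow_one]
    _ = (∫⁻ t, N t ∂μ) ^ r := by
        by_cases h0 : ∫⁻ t, N t ∂μ = 0
        · rw [h0, zero_mul, ENNReal.zero_rpow_of_pos hr0]
        · nth_rewrite 1 [← ENNReal.rpow_one (∫⁻ t, N t ∂μ)]
          rw [← ENNReal.rpow_add _ _ h0 htop, hsr]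

/-- Minkowski's integral inequality. -/
theorem lpSupNorm_lintegral_le {p : ℝ≥0∞} (hp : 1 ≤ p)
    {F : Euc n → T → ℝ≥0∞} (hF : Measurable (Function.uncurry F)) :
    lpSupNorm p (fun y => ∫⁻ t, F y t ∂μ) ≤ ∫⁻ t, lpSupNorm p (fun y => F y t) ∂μ := by
  by_cases hp' : p = ∞
  · simp only [lpSupNorm, if_pos hp']
    exact iSup_le fun y => lintegral_mono fun t => le_iSup (fun y => F y t) y
  simp only [lpSupNorm, if_neg hp']
  have hr := one_le_toReal hp hp'
  rcases hr.eq_or_lt with h1 | h1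
  · rw [← h1]
    simp only [ENNReal.rpow_one, one_div_one]
    exact (lintegral_lintegral_swap hF.aemeasurable).le
  · have hr0 : 0 < p.toReal := by linarith
    have h2 := lintegral_lintegral_rpow_le (μ := μ) (Real.HolderConjugate.conjExponent h1) hF
    refine (ENNReal.rpow_le_rpow h2 (by positivity : 0 ≤ 1 / p.toReal)).trans (le_of_eq ?_)
    rw [← ENNReal.rpow_mul, mul_one_div_cancel hr0.ne', ENNReal.rpow_one]

/-- Young's inequality for convolutions with an integrable function. -/
theorem lpSupNorm_convolution_le {p : ℝ≥0∞} (hp : 1 ≤ p) {v : Euc n → ℂ} (hv : Measurable v)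
    {k : Euc n → ℝ≥0∞} (hk : Measurable k) :
    lpSupNorm p (fun y => ∫⁻ x, ‖v x‖ₑ * k (x - y)) ≤ eLpNorm v p volume * ∫⁻ z, k z := by
  have h1 : ∀ y, ∫⁻ x, ‖v x‖ₑ * k (x - y) = ∫⁻ z, k z * ‖v (y + z)‖ₑ := fun y => by
    rw [← lintegral_add_right_eq_self (fun x => ‖v x‖ₑ * k (x - y)) y]
    refine lintegral_congr fun z => ?_
    rw [add_sub_cancel_right, mul_comm, add_comm]
  simp only [h1]
  by_cases hp' : p = ∞
  · subst hp'
    rw [lpSupNorm, if_pos rfl, eLpNorm_exponent_top]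
    refine iSup_le fun y => ?_
    rw [← lintegral_const_mul _ hk]
    have h2 : ∀ᵐ z : Euc n, ‖v (y + z)‖ₑ ≤ eLpNormEssSup v volume :=
      (measurePreserving_add_left volume y).quasiMeasurePreserving.ae
        (ae_le_eLpNormEssSup (f := v) (μ := volume))
    refine lintegral_mono_ae ?_
    filter_upwards [h2] with z hz
    rw [mul_comm]
    gcongr
  · have hm : Measurable (Function.uncurry fun y z : Euc n => k z * ‖v (y + z)‖ₑ) :=
      (hk.comp measurable_snd).mul (hv.comp measurable_add).enorm
    refine (lpSupNorm_lintegral_le hp hm).trans (le_of_eq ?_)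
    rw [← lintegral_const_mul _ hk]
    refine lintegral_congr fun z => ?_
    have hvz : Measurable fun y => ‖v (y + z)‖ₑ := (hv.comp (measurable_add_const z)).enorm
    rw [lpSupNorm_const_mul hp _ hvz,
      lpSupNorm_comp_add_right p (fun y => ‖v y‖ₑ), lpSupNorm_enorm hp hp', mul_comm]

theorem measurable_lpSupNorm {p : ℝ≥0∞} {F : Euc n → Euc n → ℂ}
    (hF : Continuous (Function.uncurry F)) :
    Measurable fun ξ => lpSupNorm p (fun y => ‖F y ξ‖ₑ) := by
  unfold lpSupNorm
  split_ifs
  · refine LowerSemicontinuous.measurable (lowerSemicontinuous_iSup fun y => ?_)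
    exact (continuous_enorm.comp (hF.comp (by fun_prop :
      Continuous fun ξ : Euc n => (y, ξ)))).lowerSemicontinuous
  · have : Measurable fun q : Euc n × Euc n => ‖F q.2 q.1‖ₑ ^ p.toReal :=
      ((hF.comp continuous_swap).measurable.enorm).pow_const _
    exact this.lintegral_prod_right'.pow_const _

theorem measurable_windowFun (p : ℝ≥0∞) (χ : 𝓢(Euc n, ℂ)) (u : 𝓢'(Euc n, ℂ)) :
    Measurable (windowFun p χ u) :=
  measurable_lpSupNorm (continuous_localFourier u χ)

end Minkowski

/-! ### Localization and supports of tempered distributions -/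

section Support

variable {n : ℕ}

/-- An integrable weight of polynomial decay on `ℝⁿ`. -/
def decayWeight (x : Euc n) : ℝ := ((1 + ‖x‖) ^ (n + 1))⁻¹

theorem decayWeight_nonneg (x : Euc n) : 0 ≤ decayWeight x := by unfold decayWeight; positivity

theorem continuous_decayWeight : Continuous (decayWeight (n := n)) := by
  unfold decayWeight
  exact Continuous.inv₀ (by fun_prop) fun x => by positivity

theorem integrable_decayWeight : Integrable (decayWeight (n := n)) := by
  have h := integrable_one_add_norm (μ := (volume : Measure (Euc n))) (r := n + 1) (by simp)
  refine h.congr (.of_forall fun x => ?_)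
  simp only [decayWeight]
  rw [Real.rpow_neg (by positivity)]
  norm_cast

theorem le_mul_decayWeight {a C : ℝ} {x : Euc n} (h : (1 + ‖x‖) ^ (n + 1) * a ≤ C) :
    a ≤ C * decayWeight x := by
  rw [decayWeight, ← div_eq_mul_inv, le_div_iff₀' (by positivity)]
  exact h

/-- Rapid decay of `η ↦ φ * τ_η g`, for an arbitrary continuous seminorm. -/
theorem exists_seminorm_mul_translate_le_decayWeight (q : Seminorm ℂ 𝓢(Euc n, ℂ))
    (hq : Continuous q) (φ g : 𝓢(Euc n, ℂ)) :
    ∃ C : ℝ, 0 ≤ C ∧ ∀ η : Euc n, q (mulSchwartz φ (translate η g)) ≤ C * decayWeight η := by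
  obtain ⟨s, C, hC, h⟩ := exists_le_sum_seminorm q hq
  choose D hD h' using fun i : ℕ × ℕ => exists_seminorm_mul_translate_le φ g i.1 i.2 (n + 1)
  refine ⟨C * ∑ i ∈ s, D i, mul_nonneg hC (Finset.sum_nonneg fun i _ => hD i), fun η => ?_⟩
  refine (h _).trans ?_
  rw [mul_assoc, Finset.sum_mul]
  exact mul_le_mul_of_nonneg_left
    (Finset.sum_le_sum fun i _ => le_mul_decayWeight (h' i η)) hC

theorem isIntegrableFamily_mul_translate (φ g : 𝓢(Euc n, ℂ)) :
    IsIntegrableFamily volume fun t : Euc n => mulSchwartz φ (translate t g) where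
  continuous := (mulSchwartz φ).continuous.comp
    (continuous_translate.comp (continuous_id.prodMk continuous_const))
  integrable k l := by
    have hcont : Continuous fun t : Euc n =>
        SchwartzMap.seminorm ℂ k l (mulSchwartz φ (translate t g)) :=
      (continuous_seminorm k l).comp ((mulSchwartz φ).continuous.comp
        (continuous_translate.comp (continuous_id.prodMk continuous_const)))
    obtain ⟨C, hC, h⟩ := exists_seminorm_mul_translate_le_decayWeight _
      (continuous_seminorm k l) φ g
    refine Integrable.mono' (integrable_decayWeight.const_mul C)
      hcont.aestronglyMeasurable (.of_forall fun t => ?_)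
    rw [Real.norm_of_nonneg (apply_nonneg _ _)]
    exact h t

/-- A distribution which vanishes on all the localizations `θ * τ_t ρ` vanishes on `θ`, since `θ`
is the integral of its localizations. -/
theorem apply_eq_zero_of_forall_mul_translate (f : 𝓢'(Euc n, ℂ)) (θ ρ : 𝓢(Euc n, ℂ))
    (hρ : ∫ x, ρ x = 1) (h : ∀ t, f (mulSchwartz θ (translate t ρ)) = 0) : f θ = 0 := by
  have hg : ∀ x, θ x = ∫ t, mulSchwartz θ (translate t ρ) x := fun x => by
    simp only [mulSchwartz_apply, SchwartzMap.compSubConstCLM_apply]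
    rw [integral_const_mul, integral_sub_left_eq_self (fun x => ρ x), hρ, mul_one]
  have h1 := (isIntegrableFamily_mul_translate θ ρ).apply_eq_integral hg f
  refine h1.trans ?_
  exact (integral_congr_ae (.of_forall h)).trans (integral_zero _ _)

/-- Mollifiers with arbitrarily small supports. -/
theorem exists_mollifier (n : ℕ) {ε : ℝ} (hε : 0 < ε) :
    ∃ ρ : 𝓢(Euc n, ℂ), tsupport ρ ⊆ Metric.closedBall 0 ε ∧ ∫ x, ρ x = 1 := by
  let b : ContDiffBump (0 : Euc n) := ⟨ε / 2, ε, by positivity, by linarith⟩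
  have hs : ContDiff ℝ (⊤ : ℕ∞) (Complex.ofRealCLM ∘ b.normed volume) :=
    Complex.ofRealCLM.contDiff.comp b.contDiff_normed
  have hc : HasCompactSupport (Complex.ofRealCLM ∘ b.normed volume) :=
    b.hasCompactSupport_normed.comp_left rfl
  refine ⟨hc.toSchwartzMap hs, ?_, ?_⟩
  · rw [← show tsupport (b.normed volume) = Metric.closedBall 0 ε from b.tsupport_normed_eq]
    exact tsupport_comp_subset (g := Complex.ofRealCLM) (map_zero Complex.ofRealCLM) _
  · have : ∀ x, hc.toSchwartzMap hs x = ((b.normed volume x : ℝ) : ℂ) := fun x => rfl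
    simp only [this]
    rw [integral_complex_ofReal, b.integral_normed, Complex.ofReal_one]

theorem tsupport_translate_subset {ρ : 𝓢(Euc n, ℂ)} {ε : ℝ}
    (h : tsupport ρ ⊆ Metric.closedBall 0 ε) (t : Euc n) :
    tsupport (translate t ρ) ⊆ Metric.closedBall t ε := by
  refine closure_minimal (fun x hx => ?_) Metric.isClosed_closedBall
  rw [Function.mem_support, SchwartzMap.compSubConstCLM_apply] at hx
  have := h (subset_tsupport _ hx)
  rwa [mem_closedBall_zero_iff, ← dist_eq_norm] at this

theorem tsupport_mulSchwartz_subset (φ g : 𝓢(Euc n, ℂ)) :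
    tsupport (mulSchwartz φ g) ⊆ tsupport φ ∩ tsupport g := by
  rw [Set.inter_comm]
  exact SchwartzMap.tsupport_smulLeftCLM_subset _ _

theorem eq_zero_of_tsupport_subset_empty {g : 𝓢(Euc n, ℂ)} (h : tsupport g ⊆ ∅) : g = 0 := by
  ext x
  exact image_eq_zero_of_notMem_tsupport fun hx => h hx

/-- A tempered distribution vanishes on the Schwartz functions whose support avoids its support:
first for compact supports, by localizing below the Lebesgue number of a cover by open sets on
which the distribution vanishes, and then in general, by localizing at a fixed scale. -/
theorem apply_eq_zero_of_disjoint_dsupport (f : 𝓢'(Euc n, ℂ)) {θ : 𝓢(Euc n, ℂ)}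
    (h : Disjoint (tsupport θ) (dsupport f)) : f θ = 0 := by
  have hcompact : ∀ θ : 𝓢(Euc n, ℂ), IsCompact (tsupport θ) →
      Disjoint (tsupport θ) (dsupport f) → f θ = 0 := fun θ hK hd => by
    rw [← Set.subset_compl_iff_disjoint_right, dsupport_compl_eq] at hd
    obtain ⟨δ, hδ, hδ'⟩ := lebesgue_number_lemma_of_metric_sUnion hK (fun t ht => ht.2) hd
    obtain ⟨ρ, hρ, hρ1⟩ := exists_mollifier n (ε := δ / 3) (by positivity)
    refine apply_eq_zero_of_forall_mul_translate f θ ρ hρ1 fun t => ?_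
    have hsub := tsupport_mulSchwartz_subset θ (translate t ρ)
    by_cases hne : ((tsupport θ) ∩ tsupport (translate t ρ)).Nonempty
    · obtain ⟨x, hx, hxt⟩ := hne
      obtain ⟨a, ha, hxa⟩ := hδ' x hx
      refine ha.1 _ fun z hz => hxa ?_
      have h1 := Metric.mem_closedBall.1 (tsupport_translate_subset hρ t hxt)
      have h2 := Metric.mem_closedBall.1 (tsupport_translate_subset hρ t (hsub hz).2)
      rw [Metric.mem_ball]
      linarith [dist_triangle_right z x t]
    · rw [Set.not_nonempty_iff_eq_empty.1 hne] at hsub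
      rw [eq_zero_of_tsupport_subset_empty hsub, map_zero]
  obtain ⟨ρ, hρ, hρ1⟩ := exists_mollifier n one_pos
  refine apply_eq_zero_of_forall_mul_translate f θ ρ hρ1 fun t => ?_
  have hsub := tsupport_mulSchwartz_subset θ (translate t ρ)
  refine hcompact _ ?_ (h.mono_left (hsub.trans Set.inter_subset_left))
  exact (isCompact_closedBall t 1).of_isClosed_subset (isClosed_tsupport _)
    (hsub.trans (Set.inter_subset_right.trans (tsupport_translate_subset hρ t)))

end Support

/-! ### The norm of a distribution is controlled by its spectral decompositions -/

section Upper

variable {n : ℕ}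

theorem exists_cutoff {Q : Set (Euc n)} (hQ : IsCompact Q) :
    ∃ (φ : 𝓢(Euc n, ℂ)) (U : Set (Euc n)), IsOpen U ∧ Q ⊆ U ∧ ∀ x ∈ U, φ x = 1 := by
  obtain ⟨R, hR, hQR⟩ := hQ.isBounded.subset_ball_lt 0 0
  let b : ContDiffBump (0 : Euc n) := ⟨R, R + 1, hR, by linarith⟩
  have hs : ContDiff ℝ (⊤ : ℕ∞) (Complex.ofRealCLM ∘ b) :=
    Complex.ofRealCLM.contDiff.comp b.contDiff
  have hc : HasCompactSupport (Complex.ofRealCLM ∘ b) := b.hasCompactSupport.comp_left rfl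
  refine ⟨hc.toSchwartzMap hs, Metric.ball 0 R, Metric.isOpen_ball, hQR, fun x hx => ?_⟩
  have : hc.toSchwartzMap hs x = ((b x : ℝ) : ℂ) := rfl
  rw [this, b.one_of_mem_closedBall (Metric.ball_subset_closedBall hx), Complex.ofReal_one]

/-- A distribution with spectrum in `γ + Q` is not changed by a spectral cutoff which is equal
to one near `γ + Q`. -/
theorem apply_schwartzHat_mul_translate (f : 𝓢'(Euc n, ℂ)) {Q U : Set (Euc n)} (hU : IsOpen U)
    (hQU : Q ⊆ U) {φ : 𝓢(Euc n, ℂ)} (hφ : ∀ x ∈ U, φ x = 1) (γ : Euc n)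
    (hf : dsupport (distHat f) ⊆ (fun x => γ + x) '' Q) (ψ : 𝓢(Euc n, ℂ)) :
    f (schwartzHat n ψ) = f (schwartzHat n (mulSchwartz (translate γ φ) ψ)) := by
  have hopen : IsOpen ((fun x => γ + x) '' U) := (Homeomorph.addLeft γ).isOpenMap U hU
  have hzero : distHat f (ψ - mulSchwartz (translate γ φ) ψ) = 0 := by
    refine apply_eq_zero_of_disjoint_dsupport _ (Disjoint.mono_right
      (hf.trans (Set.image_mono hQU)) ?_)
    rw [← Set.subset_compl_iff_disjoint_right]
    refine closure_minimal (fun x hx hxU => hx ?_) hopen.isClosed_compl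
    obtain ⟨z, hz, rfl⟩ := hxU
    simp [mulSchwartz_apply, hφ z hz]
  rw [distHat_apply, map_sub] at hzero
  rw [map_sub] at hzero
  exact sub_eq_zero.1 hzero

/-- The kernel `H(φ * τ_η (H⁻¹ χ))`, with `H` the Fourier transform, of the windowed Fourier
transform of functions with spectrum near the origin. -/
def windowKernel (φ χ : 𝓢(Euc n, ℂ)) (η : Euc n) : 𝓢(Euc n, ℂ) :=
  schwartzHat n (mulSchwartz φ (translate η (schwartzUnhat n χ)))

theorem norm_schwartzHat_mul_unhat_modTranslate (φ χ : 𝓢(Euc n, ℂ)) (γ y ξ x : Euc n) :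
    ‖schwartzHat n (mulSchwartz (translate γ φ) (schwartzUnhat n (modTranslate χ y ξ))) x‖
      = ‖windowKernel φ χ (ξ - γ) (x - y)‖ := by
  have h : mulSchwartz (translate γ φ) (schwartzUnhat n (modTranslate χ y ξ))
      = character (-y) (γ - ξ) • translate γ (modulate (-y)
        (mulSchwartz φ (translate (ξ - γ) (schwartzUnhat n χ)))) := by
    ext z
    rw [modTranslate_eq, schwartzUnhat_modulate, schwartzUnhat_translate]
    simp only [smul_apply, mulSchwartz_apply, modulate_apply,
      SchwartzMap.compSubConstCLM_apply, smul_eq_mul]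
    rw [show z - γ - (ξ - γ) = z - ξ by abel, show z - ξ = (γ - ξ) + (z - γ) by abel,
      character_add]
    ring
  rw [h, map_smul, schwartzHat_translate, schwartzHat_modulate, neg_neg]
  simp only [smul_apply, modulate_apply, SchwartzMap.compSubConstCLM_apply, smul_eq_mul,
    norm_mul, norm_character, one_mul, windowKernel]

theorem exists_lintegral_windowKernel_le (φ χ : 𝓢(Euc n, ℂ)) :
    ∃ C : ℝ≥0, ∀ η : Euc n,
      ∫⁻ z, ‖windowKernel φ χ η z‖ₑ ≤ C * ENNReal.ofReal (decayWeight η) := by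
  obtain ⟨k, C, h⟩ := SchwartzMap.eLpNorm_le_seminorm (E := Euc n) ℂ ℂ 1 volume
  let q : Seminorm ℂ 𝓢(Euc n, ℂ) := (supSeminorm k 0).comp (schwartzHat n).toLinearMap
  obtain ⟨D, hD, h'⟩ := exists_seminorm_mul_translate_le_decayWeight q
    ((continuous_supSeminorm k 0).comp (schwartzHat n).continuous) φ (schwartzUnhat n χ)
  refine ⟨C * D.toNNReal, fun η => ?_⟩
  have h1 := h (windowKernel φ χ η)
  rw [eLpNorm_one_eq_lintegral_enorm] at h1
  refine h1.trans ?_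
  rw [ENNReal.coe_mul, mul_assoc]
  refine mul_le_mul_right ?_ _
  have h2 : ENNReal.ofReal (D * decayWeight η) = D.toNNReal * ENNReal.ofReal (decayWeight η) := by
    rw [ENNReal.ofReal_mul hD]; rfl
  rw [← h2]
  exact ENNReal.ofReal_le_ofReal (h' η)

/-- The function `U_{χ,p}` of an `L^p` function with spectrum in `γ + Q` is concentrated near
`γ`. -/
theorem windowFun_toTemperedDistribution_le {p : ℝ≥0∞} [hp : Fact (1 ≤ p)] {Q U : Set (Euc n)}
    (hU : IsOpen U) (hQU : Q ⊆ U) {φ : 𝓢(Euc n, ℂ)} (hφ : ∀ x ∈ U, φ x = 1) (γ : Euc n)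
    (v : Lp ℂ p (volume : Measure (Euc n)))
    (hv : dsupport (distHat (Lp.toTemperedDistribution v)) ⊆ (fun x => γ + x) '' Q)
    (χ : 𝓢(Euc n, ℂ)) (ξ : Euc n) :
    windowFun p χ (Lp.toTemperedDistribution v) ξ
      ≤ ‖v‖ₑ * ∫⁻ z, ‖windowKernel φ χ (ξ - γ) z‖ₑ := by
  have h1 : ∀ y, ‖localFourier (Lp.toTemperedDistribution v) χ y ξ‖ₑ
      ≤ ∫⁻ x, ‖v x‖ₑ * ‖windowKernel φ χ (ξ - γ) (x - y)‖ₑ := fun y => by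
    have h2 := apply_schwartzHat_mul_translate _ hU hQU hφ γ hv
      (schwartzUnhat n (modTranslate χ y ξ))
    rw [schwartzHat_schwartzUnhat] at h2
    rw [localFourier, h2, Lp.toTemperedDistribution_apply]
    refine (enorm_integral_le_lintegral_enorm _).trans (le_of_eq (lintegral_congr fun x => ?_))
    rw [enorm_smul, mul_comm]
    congr 1
    rw [← ofReal_norm, ← ofReal_norm, norm_schwartzHat_mul_unhat_modTranslate]
  rw [windowFun_eq_lpSupNorm]
  refine (lpSupNorm_mono p h1).trans ?_
  refine (lpSupNorm_convolution_le hp.out (Lp.stronglyMeasurable v).measurable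
    (windowKernel φ χ (ξ - γ)).continuous.measurable.enorm).trans (le_of_eq ?_)
  rw [Lp.enorm_def]

theorem lpSupNorm_tsum_le {ι : Type*} [Countable ι] {p : ℝ≥0∞} (hp : 1 ≤ p)
    {F : Euc n → ι → ℝ≥0∞} (hF : ∀ i, Measurable fun y => F y i) :
    lpSupNorm p (fun y => ∑' i, F y i) ≤ ∑' i, lpSupNorm p (fun y => F y i) := by
  let : MeasurableSpace ι := ⊤
  have hF' : Measurable (Function.uncurry F) := measurable_from_prod_countable_left hF
  have := lpSupNorm_lintegral_le (μ := Measure.count) hp hF'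
  simpa only [lintegral_count] using this

theorem windowFun_le_tsum {ι : Type*} [Countable ι] {p : ℝ≥0∞} (hp : 1 ≤ p)
    (χ : 𝓢(Euc n, ℂ)) {u : 𝓢'(Euc n, ℂ)} {w : ι → 𝓢'(Euc n, ℂ)} (h : HasSum w u) (ξ : Euc n) :
    windowFun p χ u ξ ≤ ∑' i, windowFun p χ (w i) ξ := by
  have h1 : ∀ y, ‖localFourier u χ y ξ‖ₑ ≤ ∑' i, ‖localFourier (w i) χ y ξ‖ₑ := fun y => by
    have h2 : HasSum (fun i => localFourier (w i) χ y ξ) (localFourier u χ y ξ) :=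
      h.mapL (PointwiseConvergenceCLM.evalCLM (RingHom.id ℂ) ℂ (modTranslate χ y ξ))
    rw [← h2.tsum_eq]
    exact enorm_tsum_le_tsum_enorm
  simp only [windowFun_eq_lpSupNorm]
  refine (lpSupNorm_mono p h1).trans (lpSupNorm_tsum_le hp fun i => ?_)
  exact ((continuous_localFourier (w i) χ).comp
    (by fun_prop : Continuous fun y => (y, ξ))).measurable.enorm

/-- The `S_w^p` norm is controlled by all decompositions with spectra in the translates of `Q`. -/
theorem exists_swNorm_le {Γ : Submodule ℤ (Euc n)} [Countable Γ] {Q : Set (Euc n)}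
    (hQ : IsCompact Q) (χ : 𝓢(Euc n, ℂ)) :
    ∃ C : ℝ≥0, ∀ (p : ℝ≥0∞) [Fact (1 ≤ p)] (u : 𝓢'(Euc n, ℂ))
      (v : Γ → Lp ℂ p (volume : Measure (Euc n))), IsSpectralDecomposition Γ Q p u v →
        swNorm p χ u ≤ C * ∑' γ : Γ, ‖v γ‖ₑ := by
  obtain ⟨φ, U, hU, hQU, hφ⟩ := exists_cutoff hQ
  obtain ⟨C, hC⟩ := exists_lintegral_windowKernel_le φ χ
  set I := ∫⁻ η : Euc n, ENNReal.ofReal (decayWeight η)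
  have hI : I ≠ ∞ := by
    have := (integrable_decayWeight (n := n)).lintegral_lt_top
    exact this.ne
  refine ⟨C * I.toNNReal, fun p hp u v hv => ?_⟩
  have hm : ∀ γ : Γ, Measurable fun ξ : Euc n =>
      ‖v γ‖ₑ * (C * ENNReal.ofReal (decayWeight (ξ - (γ : Euc n)))) := fun γ =>
    ((continuous_decayWeight.comp
      (continuous_id.sub continuous_const)).measurable.ennreal_ofReal.const_mul _).const_mul _
  calc swNorm p χ u
      ≤ ∫⁻ ξ, ∑' γ : Γ, ‖v γ‖ₑ * (C * ENNReal.ofReal (decayWeight (ξ - (γ : Euc n)))) := by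
        refine lintegral_mono fun ξ => (windowFun_le_tsum hp.out χ hv.hasSum ξ).trans ?_
        refine ENNReal.tsum_le_tsum fun γ => ?_
        refine (windowFun_toTemperedDistribution_le hU hQU hφ γ (v γ) (hv.spectrum_subset γ) χ
          ξ).trans ?_
        exact mul_le_mul_right (hC _) _
    _ = ∑' γ : Γ, ‖v γ‖ₑ * (C * I) := by
        rw [lintegral_tsum fun γ => (hm γ).aemeasurable]
        refine tsum_congr fun γ => ?_
        rw [lintegral_const_mul' _ _ enorm_ne_top, lintegral_const_mul' _ _ ENNReal.coe_ne_top,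
          lintegral_sub_right_eq_self (fun ξ : Euc n => ENNReal.ofReal (decayWeight ξ))]
    _ = _ := by
        rw [ENNReal.tsum_mul_right, mul_comm, ENNReal.coe_mul, ENNReal.coe_toNNReal hI]

end Upper

/-! ### Lattice sums and a smooth partition of unity -/

section Lattice

variable {n : ℕ} (Γ : Submodule ℤ (Euc n)) [DiscreteTopology Γ] [IsZLattice ℝ Γ]

theorem summable_decayWeight_lattice : Summable fun γ : Γ => decayWeight (γ : Euc n) := by
  have hr : Module.finrank ℤ Γ < n + 1 := by
    rw [ZLattice.rank ℝ Γ, finrank_euclideanSpace, Fintype.card_fin]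
    exact Nat.lt_succ_self n
  refine Summable.of_norm_bounded_eventually (ZLattice.summable_norm_pow_inv Γ (n + 1) hr) ?_
  refine (Set.finite_singleton (0 : Γ)).subset fun γ hγ => ?_
  by_contra h0
  refine hγ ?_
  have hpos : 0 < ‖γ‖ := norm_pos_iff.2 h0
  change ‖decayWeight (γ : Euc n)‖ ≤ ‖γ‖⁻¹ ^ (n + 1)
  rw [Real.norm_of_nonneg (decayWeight_nonneg _), decayWeight, inv_pow]
  refine inv_anti₀ (by positivity) (pow_le_pow_left₀ hpos.le ?_ _)
  rw [Submodule.coe_norm]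
  linarith

/-- Every point may be translated by the lattice into a fixed ball, which contains a fundamental
domain. -/
theorem exists_add_mem_bounded : ∃ R : ℝ, 0 ≤ R ∧ ∀ ξ : Euc n, ∃ γ : Γ, ‖(γ : Euc n) + ξ‖ ≤ R := by
  let b := Module.Free.chooseBasis ℤ Γ
  obtain ⟨R, hR⟩ := (ZSpan.fundamentalDomain_isBounded (b.ofZLatticeBasis ℝ)).exists_norm_le
  refine ⟨max R 0, le_max_right _ _, fun ξ => ?_⟩
  obtain ⟨v, hv, -⟩ := ZSpan.exist_unique_vadd_mem_fundamentalDomain (b.ofZLatticeBasis ℝ) ξ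
  refine ⟨⟨v, ?_⟩, (hR _ hv).trans (le_max_left _ _)⟩
  exact (b.ofZLatticeBasis_span ℝ).le v.2

/-- The sums of a rapidly decaying function over the translates of a lattice are bounded: modulo
the lattice, the translation may be taken bounded. -/
theorem exists_tsum_decayWeight_le :
    ∃ K : ℝ≥0, ∀ ξ : Euc n, ∑' γ : Γ, ENNReal.ofReal (decayWeight (ξ - (γ : Euc n))) ≤ K := by
  obtain ⟨R, hR, h⟩ := exists_add_mem_bounded Γ
  have hs := summable_decayWeight_lattice Γ
  refine ⟨Real.toNNReal ((1 + R) ^ (n + 1) * ∑' γ : Γ, decayWeight (γ : Euc n)), fun ξ => ?_⟩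
  obtain ⟨v, hv⟩ := h ξ
  have h1 : ∀ γ : Γ, decayWeight (ξ - ((Equiv.subRight v γ : Γ) : Euc n))
      ≤ (1 + R) ^ (n + 1) * decayWeight (γ : Euc n) := fun γ => by
    have h2 : 1 + ‖(γ : Euc n)‖ ≤ (1 + R) * (1 + ‖ξ - ((Equiv.subRight v γ : Γ) : Euc n)‖) := by
      have h3 := one_add_norm_le_mul (γ : Euc n) ((v : Euc n) + ξ)
      rw [show ‖(γ : Euc n) - ((v : Euc n) + ξ)‖ = ‖ξ - ((Equiv.subRight v γ : Γ) : Euc n)‖ by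
        rw [← norm_neg]; congr 1; simp; abel] at h3
      exact h3.trans (mul_le_mul_of_nonneg_right (by linarith) (by positivity))
    rw [decayWeight, decayWeight, ← div_eq_mul_inv, le_div_iff₀ (by positivity),
      inv_mul_le_iff₀ (by positivity), mul_comm, ← mul_pow]
    exact pow_le_pow_left₀ (by positivity) h2 _
  rw [← (Equiv.subRight v).tsum_eq]
  refine (ENNReal.tsum_le_tsum fun γ => ENNReal.ofReal_le_ofReal (h1 γ)).trans ?_
  rw [← ENNReal.ofReal_tsum_of_nonneg (fun γ => mul_nonneg (by positivity) (decayWeight_nonneg _))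
    (hs.mul_left _), tsum_mul_left]
  rfl

theorem exists_tsum_enorm_le (a : 𝓢(Euc n, ℂ)) :
    ∃ K : ℝ≥0, ∀ ξ : Euc n, ∑' γ : Γ, ‖a (ξ - (γ : Euc n))‖ₑ ≤ K := by
  obtain ⟨K, hK⟩ := exists_tsum_decayWeight_le Γ
  let C : ℝ := 2 ^ (n + 1) * supSeminorm (n + 1) 0 a
  have h1 : ∀ x, ‖a x‖ₑ ≤ ENNReal.ofReal C * ENNReal.ofReal (decayWeight x) := fun x => by
    rw [← ENNReal.ofReal_mul (by positivity), ← ofReal_norm]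
    refine ENNReal.ofReal_le_ofReal (le_mul_decayWeight ?_)
    simpa using one_add_pow_mul_le (k := n + 1) (l := 0) a le_rfl x
  refine ⟨C.toNNReal * K, fun ξ => ?_⟩
  refine (ENNReal.tsum_le_tsum fun γ => h1 _).trans ?_
  rw [ENNReal.tsum_mul_left, ENNReal.coe_mul]
  exact mul_le_mul_right (hK ξ) _

/-- A smooth compactly supported function whose translates by the lattice sum to one: the
regularized indicator function of a fundamental domain. -/
theorem exists_partition :
    ∃ φ : 𝓢(Euc n, ℂ), HasCompactSupport φ ∧ ∀ x, HasSum (fun γ : Γ => φ (x - (γ : Euc n))) 1 := by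
  let b := Module.Free.chooseBasis ℤ Γ
  let F := ZSpan.fundamentalDomain (b.ofZLatticeBasis ℝ)
  have hF : IsAddFundamentalDomain Γ F volume := ZLattice.isAddFundamentalDomain b volume
  have hFm : MeasurableSet F := ZSpan.fundamentalDomain_measurableSet _
  have hFb : Bornology.IsBounded F := ZSpan.fundamentalDomain_isBounded _
  obtain ⟨ρ, hρ, hρ1⟩ := exists_mollifier n one_pos
  have hρc : HasCompactSupport ρ :=
    (isCompact_closedBall 0 1).of_isClosed_subset (isClosed_tsupport _) hρ
  let g : Euc n → ℂ := MeasureTheory.convolution (F.indicator fun _ => (1 : ℂ)) ρ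
    (ContinuousLinearMap.mul ℝ ℂ) volume
  have hg : ∀ x, g x = ∫ t in F, ρ (x - t) := fun x => by
    rw [← integral_indicator hFm]
    refine integral_congr_ae (.of_forall fun t => ?_)
    by_cases ht : t ∈ F <;> simp [ht]
  have hloc : LocallyIntegrable (F.indicator fun _ => (1 : ℂ)) volume :=
    ((integrable_indicator_iff hFm).2
      (integrableOn_const hFb.measure_lt_top.ne)).locallyIntegrable
  have hsmooth : ContDiff ℝ (⊤ : ℕ∞) g :=
    hρc.contDiff_convolution_right _ hloc ρ.smooth'
  have hcomp : HasCompactSupport g := by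
    refine HasCompactSupport.convolution _ ?_ hρc
    exact HasCompactSupport.intro' hFb.isCompact_closure isClosed_closure
      fun x hx => Set.indicator_of_notMem (fun h => hx (subset_closure h)) _
  refine ⟨hcomp.toSchwartzMap hsmooth, hcomp, fun x => ?_⟩
  have hint : Integrable fun t => ρ (x - t) := ρ.integrable.comp_sub_left x
  have : VAddInvariantMeasure Γ (Euc n) volume :=
    inferInstanceAs (VAddInvariantMeasure Γ.toAddSubgroup (Euc n) volume)
  -- The integral of `ρ (x - t)` over `t`, which is one, is unfolded over the translates of `F`.
  have h1 := hF.integral_eq_tsum'' (fun t => ρ (x - t)) hint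
  rw [integral_sub_left_eq_self (fun t => ρ t), hρ1] at h1
  have h2 : ∀ γ : Γ, ∫ t in F, ρ (x - (γ +ᵥ t)) = g (x - (γ : Euc n)) := fun γ => by
    rw [hg]
    refine integral_congr_ae (.of_forall fun t => ?_)
    simp only [Submodule.vadd_def, vadd_eq_add]
    congr 1; abel
  simp only [h2] at h1
  have hsum : Summable fun γ : Γ => g (x - (γ : Euc n)) := by
    let φ : 𝓢(Euc n, ℂ) := hcomp.toSchwartzMap hsmooth
    obtain ⟨K, hK⟩ := exists_tsum_enorm_le Γ φ
    exact Summable.of_enorm ((hK x).trans_lt ENNReal.coe_lt_top).ne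
  exact h1 ▸ hsum.hasSum

end Lattice

/-! ### Fourier multipliers applied to tempered distributions -/

section Multiplier

variable {n : ℕ}

theorem inversionConst_ne_zero : (inversionConst n : ℂ) ≠ 0 := by
  rw [inversionConst]
  exact_mod_cast (by positivity : ((2 * Real.pi) ^ n)⁻¹ ≠ 0)

/-- The function `φ(D) u`, the inverse Fourier transform of `φ * û`, for a tempered distribution
`u` and a Schwartz function `φ`. -/
def multiplier (φ : 𝓢(Euc n, ℂ)) (u : 𝓢'(Euc n, ℂ)) (x : Euc n) : ℂ :=
  u ((inversionConst n : ℂ) • translate x (schwartzHat n φ))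

theorem continuous_multiplier (φ : 𝓢(Euc n, ℂ)) (u : 𝓢'(Euc n, ℂ)) :
    Continuous (multiplier φ u) := by
  have h : Continuous fun x : Euc n => translate x (schwartzHat n φ) :=
    continuous_translate.comp (continuous_id.prodMk continuous_const)
  exact u.continuous.comp (h.const_smul (inversionConst n : ℂ))

theorem integrable_pow_mul_norm (f : 𝓢(Euc n, ℂ)) (N : ℕ) :
    Integrable fun x : Euc n => (1 + ‖x‖) ^ N * ‖f x‖ := by
  refine Integrable.mono' (integrable_decayWeight.const_mul
    (2 ^ (n + 1 + N) * supSeminorm (n + 1 + N) 0 f)) (by fun_prop) (.of_forall fun x => ?_)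
  rw [Real.norm_of_nonneg (by positivity)]
  refine le_mul_decayWeight ?_
  rw [← mul_assoc, ← pow_add]
  simpa using one_add_pow_mul_le (k := n + 1 + N) (l := 0) f le_rfl x

theorem isIntegrableFamily_smul_translate (ψ g : 𝓢(Euc n, ℂ)) :
    IsIntegrableFamily volume fun x : Euc n => ψ x • translate x g where
  continuous := ψ.continuous.smul
    (continuous_translate.comp (continuous_id.prodMk continuous_const))
  integrable k l := by
    have hcont : Continuous fun x : Euc n => SchwartzMap.seminorm ℂ k l (ψ x • translate x g) :=
      (continuous_seminorm k l).comp (ψ.continuous.smul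
        (continuous_translate.comp (continuous_id.prodMk continuous_const)))
    refine Integrable.mono' ((integrable_pow_mul_norm ψ k).mul_const (2 ^ k * supSeminorm k l g))
      hcont.aestronglyMeasurable (.of_forall fun x => ?_)
    rw [Real.norm_of_nonneg (apply_nonneg _ _), map_smul_eq_mul, mul_comm ((1 + ‖x‖) ^ k), mul_assoc]
    exact mul_le_mul_of_nonneg_left (seminorm_translate_le k l x g) (norm_nonneg _)

/-- The distribution `φ(D) u` is the function `multiplier φ u`, paired with `ψ` by integration. -/
theorem apply_schwartzHat_mul_schwartzUnhat (φ : 𝓢(Euc n, ℂ)) (u : 𝓢'(Euc n, ℂ))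
    (ψ : 𝓢(Euc n, ℂ)) :
    u (schwartzHat n (mulSchwartz φ (schwartzUnhat n ψ))) = ∫ x, ψ x * multiplier φ u x := by
  have hg : ∀ z, schwartzHat n (mulSchwartz φ (schwartzUnhat n ψ)) z
      = ∫ x, (ψ x • translate x ((inversionConst n : ℂ) • schwartzHat n φ)) z := fun z => by
    rw [schwartzHat_mul_schwartzUnhat, ← integral_const_mul]
    refine integral_congr_ae (.of_forall fun x => ?_)
    simp only [smul_apply, SchwartzMap.compSubConstCLM_apply, smul_eq_mul]
    ring
  refine ((isIntegrableFamily_smul_translate ψ _).apply_eq_integral hg u).trans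
    (integral_congr_ae (.of_forall fun x => ?_))
  exact (map_smul u (ψ x) _).trans
    (congrArg (fun g => ψ x * u g) (map_smul (translate x) (inversionConst n : ℂ) _))

/-- Tempered distributions may be applied termwise to series of Schwartz functions all of whose
seminorms are summable. -/
theorem hasSum_apply {ι : Type*} [Countable ι] {f : ι → 𝓢(Euc n, ℂ)} {g : 𝓢(Euc n, ℂ)}
    (hf : ∀ q : Seminorm ℂ 𝓢(Euc n, ℂ), Continuous q → Summable fun i => q (f i))
    (hg : ∀ x, HasSum (fun i => f i x) (g x)) (u : 𝓢(Euc n, ℂ) →L[ℂ] ℂ) :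
    HasSum (fun i => u (f i)) (u g) := by
  let _ : MeasurableSpace ι := ⊤
  let _ : TopologicalSpace ι := ⊥
  have : DiscreteTopology ι := ⟨rfl⟩
  have hint : ∀ {a : ι → ℂ}, Summable a → ∫ i, a i ∂Measure.count = ∑' i, a i := fun {a} ha => by
    rw [integral_countable (integrable_count_iff.2 ha.norm)]
    simp only [Measure.real, Measure.count_singleton, ENNReal.toReal_one, one_smul]
  have hfam : IsIntegrableFamily Measure.count f :=
    { continuous := continuous_of_discreteTopology
      integrable := fun k l =>
        integrable_count_iff.2 (hf _ (continuous_seminorm k l)).norm }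
  let q : Seminorm ℂ 𝓢(Euc n, ℂ) := (normSeminorm ℂ ℂ).comp u.toLinearMap
  have hq : ∀ g, q g = ‖u g‖ := fun g => rfl
  have hu : Summable fun i => u (f i) := by
    refine Summable.of_norm ?_
    simpa only [hq] using hf q (continuous_norm.comp u.continuous)
  have hg' : ∀ x, g x = ∫ i, f i x ∂Measure.count := fun x => by
    rw [hint (hg x).summable, (hg x).tsum_eq]
  have h := hfam.apply_eq_integral hg' u
  rw [hint hu] at h
  rw [h]
  exact hu.hasSum

/-- The sum of the localizations of `θ` by the translates of a partition of unity. -/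
theorem hasSum_apply_mul_translate {Γ : Submodule ℤ (Euc n)} [DiscreteTopology Γ] [IsZLattice ℝ Γ]
    {φ : 𝓢(Euc n, ℂ)} (hφ : ∀ x, HasSum (fun γ : Γ => φ (x - (γ : Euc n))) 1)
    (u : 𝓢(Euc n, ℂ) →L[ℂ] ℂ) (θ : 𝓢(Euc n, ℂ)) :
    HasSum (fun γ : Γ => u (mulSchwartz (translate (γ : Euc n) φ) θ)) (u θ) := by
  have hcomm : ∀ γ : Euc n, mulSchwartz (translate γ φ) θ = mulSchwartz θ (translate γ φ) :=
    fun γ => by ext x; simp only [mulSchwartz_apply, mul_comm]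
  simp only [hcomm]
  refine hasSum_apply (fun q hq => ?_) (fun x => ?_) u
  · obtain ⟨C, hC, h⟩ := exists_seminorm_mul_translate_le_decayWeight q hq θ φ
    exact Summable.of_nonneg_of_le (fun γ => apply_nonneg _ _) (fun γ => h γ)
      ((summable_decayWeight_lattice Γ).mul_left C)
  · have h1 := (hφ x).mul_left (θ x)
    rw [mul_one] at h1
    simpa only [mulSchwartz_apply, SchwartzMap.compSubConstCLM_apply] using h1

end Multiplier

/-! ### Recovering Fourier multipliers from the windowed Fourier transform -/

section Window

variable {n : ℕ}

theorem isIntegrableFamily_modTranslate (a w χ : 𝓢(Euc n, ℂ)) :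
    IsIntegrableFamily volume fun q : Euc n × Euc n =>
      (a q.2 * w q.1 * character (-q.2) q.1) • modTranslate χ q.1 q.2 := by
  have hc : Continuous fun q : Euc n × Euc n => character (-q.2) q.1 :=
    continuous_character.comp (by fun_prop : Continuous fun q : Euc n × Euc n => (-q.2, q.1))
  have hcont : Continuous fun q : Euc n × Euc n =>
      (a q.2 * w q.1 * character (-q.2) q.1) • modTranslate χ q.1 q.2 :=
    (((a.continuous.comp continuous_snd).mul (w.continuous.comp continuous_fst)).mul hc).smul
      (continuous_modTranslate χ)
  refine ⟨hcont, fun k l => ?_⟩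
  obtain ⟨C, N, hC, h⟩ := exists_seminorm_modTranslate_le χ k l
  refine Integrable.mono'
    (((integrable_pow_mul_norm w N).mul_prod (integrable_pow_mul_norm a N)).const_mul C)
    ((continuous_seminorm k l).comp hcont).aestronglyMeasurable (.of_forall fun q => ?_)
  rw [Real.norm_of_nonneg (apply_nonneg _ _), map_smul_eq_mul, norm_mul, norm_mul, norm_character,
    mul_one]
  calc _ ≤ ‖a q.2‖ * ‖w q.1‖ * (C * ((1 + ‖q.1‖) ^ N * (1 + ‖q.2‖) ^ N)) :=
        mul_le_mul_of_nonneg_left (h q.1 q.2) (by positivity)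
    _ = _ := by ring

theorem integral_modTranslate (a w χ : 𝓢(Euc n, ℂ)) (t : Euc n) :
    ∫ q : Euc n × Euc n, ((a q.2 * w q.1 * character (-q.2) q.1) • modTranslate χ q.1 q.2) t
      = ∫ y, w y * (schwartzHat n a (t - y) * χ (t - y)) := by
  have hint : Integrable (fun q : Euc n × Euc n =>
      ((a q.2 * w q.1 * character (-q.2) q.1) • modTranslate χ q.1 q.2) t) (volume.prod volume) :=
    (isIntegrableFamily_modTranslate a w χ).integrable_apply (TemperedDistribution.delta t)
  rw [Measure.volume_eq_prod, integral_prod _ hint]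
  refine integral_congr_ae (.of_forall fun y => ?_)
  simp only [smul_apply, smul_eq_mul]
  rw [schwartzHat_apply', ← integral_mul_const, ← integral_const_mul]
  refine integral_congr_ae (.of_forall fun ξ => ?_)
  simp only [modTranslate_eq, modulate_apply, SchwartzMap.compSubConstCLM_apply]
  rw [character_comm (t - y), character_sub]
  ring

/-- The time-frequency synthesis of the convolution kernel of a multiplier. If `θ m = φ`, where `m`
is the inverse Fourier transform of `b χ`, then the kernel of the multiplier with symbol
`φ(· - γ)` is a superposition of time-frequency shifts of `χ`, concentrated near the frequency `γ`
and near the point `x`. -/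
theorem kernel_eq_integral_modTranslate {b χ θ φ : 𝓢(Euc n, ℂ)}
    (h : ∀ x, θ x * schwartzUnhat n (mulSchwartz b χ) x = φ x) (γ x t : Euc n) :
    ((inversionConst n : ℂ) • translate x (schwartzHat n (translate γ φ))) t
      = ∫ q : Euc n × Euc n, ((translate γ (schwartzUnhat n b) q.2
          * (((inversionConst n : ℂ) ^ 2 • translate x (modulate γ (schwartzHat n θ))
            : 𝓢(Euc n, ℂ))) q.1
          * character (-q.2) q.1) • modTranslate χ q.1 q.2) t := by
  set c : ℂ := (inversionConst n : ℂ)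
  have hc : c ≠ 0 := inversionConst_ne_zero
  set w : 𝓢(Euc n, ℂ) := c ^ 2 • translate x (modulate γ (schwartzHat n θ))
  set m := schwartzUnhat n (mulSchwartz b χ)
  rw [integral_modTranslate]
  have h1 := schwartzHat_mul_schwartzUnhat (translate γ m) w t
  have h2 : mulSchwartz (translate γ m) (schwartzUnhat n w)
      = c ^ 2 • modulate (-x) (translate γ φ) := by
    ext z
    simp only [w, map_smul, schwartzUnhat_translate, schwartzUnhat_modulate,
      schwartzUnhat_schwartzHat, mulSchwartz_apply, smul_apply, modulate_apply,
      SchwartzMap.compSubConstCLM_apply, smul_eq_mul, ← h]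
    ring
  have h3 : schwartzHat n (translate γ m) = modulate γ (mulSchwartz b χ) := by
    rw [schwartzHat_translate, schwartzHat_schwartzUnhat]
  rw [h2, h3, map_smul, schwartzHat_modulate, neg_neg, smul_apply, smul_eq_mul, pow_two,
    mul_assoc] at h1
  rw [smul_apply, smul_eq_mul, mul_left_cancel₀ hc h1]
  refine integral_congr_ae (.of_forall fun y => ?_)
  simp only [modulate_apply, mulSchwartz_apply, schwartzHat_translate, schwartzHat_schwartzUnhat]
  ring

/-- The pointwise bound which follows from the time-frequency synthesis of the kernel: the factor
in `ξ` localizes near the frequency `γ`, the one in `y` near the point `x`. -/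
theorem enorm_multiplier_translate_le {b χ θ φ : 𝓢(Euc n, ℂ)}
    (h : ∀ x, θ x * schwartzUnhat n (mulSchwartz b χ) x = φ x) (u : 𝓢'(Euc n, ℂ)) (γ x : Euc n) :
    ‖multiplier (translate γ φ) u x‖ₑ
      ≤ ∫⁻ ξ, ‖schwartzUnhat n b (ξ - γ)‖ₑ * ∫⁻ y, ‖localFourier u χ y ξ‖ₑ
          * (‖(inversionConst n : ℂ) ^ 2‖ₑ * ‖schwartzHat n θ (y - x)‖ₑ) := by
  have h1 := (isIntegrableFamily_modTranslate _ _ χ).apply_eq_integral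
    (kernel_eq_integral_modTranslate h γ x) u
  have h2 := (isIntegrableFamily_modTranslate (translate γ (schwartzUnhat n b))
    ((inversionConst n : ℂ) ^ 2 • translate x (modulate γ (schwartzHat n θ))) χ).integrable_apply u
  refine (le_of_eq (congrArg enorm h1)).trans ((enorm_integral_le_lintegral_enorm _).trans
    (le_of_eq ?_))
  rw [Measure.volume_eq_prod, lintegral_prod_symm _ h2.aestronglyMeasurable.enorm]
  refine lintegral_congr fun ξ => ?_
  rw [← lintegral_const_mul' _ _ enorm_ne_top]
  refine lintegral_congr fun y => ?_
  have h3 : ‖character (-ξ) y‖ₑ = 1 := by rw [← ofReal_norm, norm_character, ENNReal.ofReal_one]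
  have h4 : ‖character γ (y - x)‖ₑ = 1 := by rw [← ofReal_norm, norm_character, ENNReal.ofReal_one]
  refine (congrArg enorm (map_smul u _ _)).trans ?_
  simp only [smul_apply, smul_eq_mul, enorm_mul, h3, mul_one, modulate_apply,
    SchwartzMap.compSubConstCLM_apply, h4, one_mul, localFourier]
  ring

/-- The norm of `φ(D - γ) u` is controlled by the values of the function `U_{χ,p}` near `γ`. -/
theorem lpSupNorm_multiplier_translate_le {b χ θ φ : 𝓢(Euc n, ℂ)}
    (h : ∀ x, θ x * schwartzUnhat n (mulSchwartz b χ) x = φ x) {p : ℝ≥0∞} (hp : 1 ≤ p)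
    (u : 𝓢'(Euc n, ℂ)) (γ : Euc n) :
    lpSupNorm p (fun x => ‖multiplier (translate γ φ) u x‖ₑ)
      ≤ ∫⁻ ξ, ‖schwartzUnhat n b (ξ - γ)‖ₑ * (windowFun p χ u ξ
          * ∫⁻ z, ‖(inversionConst n : ℂ) ^ 2‖ₑ * ‖schwartzHat n θ z‖ₑ) := by
  have hV : ∀ ξ, Measurable fun y => localFourier u χ y ξ := fun ξ =>
    ((continuous_localFourier u χ).comp (by fun_prop : Continuous fun y => (y, ξ))).measurable
  have hk : Measurable fun z => ‖(inversionConst n : ℂ) ^ 2‖ₑ * ‖schwartzHat n θ z‖ₑ :=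
    (schwartzHat n θ).continuous.measurable.enorm.const_mul _
  have hF : Measurable fun q : Euc n × Euc n => ∫⁻ y, ‖localFourier u χ y q.2‖ₑ
      * (‖(inversionConst n : ℂ) ^ 2‖ₑ * ‖schwartzHat n θ (y - q.1)‖ₑ) := by
    refine Measurable.lintegral_prod_right' (f := fun r : (Euc n × Euc n) × Euc n =>
      ‖localFourier u χ r.2 r.1.2‖ₑ
        * (‖(inversionConst n : ℂ) ^ 2‖ₑ * ‖schwartzHat n θ (r.2 - r.1.1)‖ₑ)) ?_
    have h1 : Continuous fun r : (Euc n × Euc n) × Euc n => localFourier u χ r.2 r.1.2 :=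
      (continuous_localFourier u χ).comp
        (by fun_prop : Continuous fun r : (Euc n × Euc n) × Euc n => (r.2, r.1.2))
    have h2 : Continuous fun r : (Euc n × Euc n) × Euc n => schwartzHat n θ (r.2 - r.1.1) :=
      (schwartzHat n θ).continuous.comp (by fun_prop)
    exact h1.measurable.enorm.mul (h2.measurable.enorm.const_mul _)
  have ha : Measurable fun q : Euc n × Euc n => ‖schwartzUnhat n b (q.2 - γ)‖ₑ :=
    ((schwartzUnhat n b).continuous.comp
      (by fun_prop : Continuous fun q : Euc n × Euc n => q.2 - γ)).measurable.enorm
  refine (lpSupNorm_mono p (enorm_multiplier_translate_le h u γ)).trans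
    ((lpSupNorm_lintegral_le hp (ha.mul hF)).trans (lintegral_mono fun ξ => ?_))
  refine (lpSupNorm_const_mul hp _
    (hF.comp (by fun_prop : Measurable fun x : Euc n => (x, ξ)))).le.trans ?_
  refine mul_le_mul_right ((lpSupNorm_convolution_le hp (hV ξ) hk).trans ?_) _
  exact mul_le_mul_left (eLpNorm_le_lpSupNorm hp _) _

end Window

/-! ### Dividing by the Fourier transform of a localized window -/

section Division

variable {n : ℕ}

theorem re_character (ξ x : Euc n) : (character ξ x).re = Real.cos (inner ℝ x ξ) := by
  simp [character, Complex.exp_re]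

/-- The Fourier transform of a nonnegative function supported near `x₀` has no zeros at low
frequencies, because the characters with these frequencies hardly oscillate on its support. -/
theorem integral_character_mul_ne_zero {g : Euc n → ℝ} (hgc : Continuous g)
    (hgs : HasCompactSupport g) (hg0 : ∀ x, 0 ≤ g x) {x₀ : Euc n} (hgx₀ : g x₀ ≠ 0) {η : Euc n}
    (hη : ∀ x, g x ≠ 0 → ‖x - x₀‖ * ‖η‖ ≤ 1) : ∫ x, character η x * (g x : ℂ) ≠ 0 := by
  have hpos : 0 < ∫ x, g x :=
    hgc.integral_pos_of_hasCompactSupport_nonneg_nonzero hgs hg0 hgx₀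
  have hgi : Integrable g := hgc.integrable_of_hasCompactSupport hgs
  have hchar : Continuous fun x => character η (x - x₀) :=
    continuous_character.comp (by fun_prop : Continuous fun x => (η, x - x₀))
  have hint : Integrable fun x => character η (x - x₀) * (g x : ℂ) :=
    hgi.ofReal.bdd_mul (c := 1) hchar.aestronglyMeasurable
      (.of_forall fun x => (norm_character _ _).le)
  have hle : Real.cos 1 * ∫ x, g x ≤ (∫ x, character η (x - x₀) * (g x : ℂ)).re := by
    have hre : (∫ x, character η (x - x₀) * (g x : ℂ)).re
        = ∫ x, (character η (x - x₀) * (g x : ℂ)).re := (integral_re hint).symm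
    rw [hre, ← integral_const_mul]
    refine integral_mono (hgi.const_mul _) hint.re fun x => ?_
    change Real.cos 1 * g x ≤ (character η (x - x₀) * (g x : ℂ)).re
    rw [Complex.re_mul_ofReal, re_character]
    by_cases hx : g x = 0
    · rw [hx, mul_zero, mul_zero]
    refine mul_le_mul_of_nonneg_right ?_ (hg0 x)
    rw [← Real.cos_abs (inner ℝ (x - x₀) η)]
    refine Real.cos_le_cos_of_nonneg_of_le_pi (abs_nonneg _) (by linarith [Real.pi_gt_three]) ?_
    exact (abs_real_inner_le_norm _ _).trans (hη x hx)
  have hmul : ∫ x, character η x * (g x : ℂ)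
      = character η x₀ * ∫ x, character η (x - x₀) * (g x : ℂ) := by
    rw [← integral_const_mul]
    refine integral_congr_ae (.of_forall fun x => ?_)
    change character η x * (g x : ℂ) = character η x₀ * (character η (x - x₀) * (g x : ℂ))
    rw [← mul_assoc, ← character_add, add_sub_cancel]
  rw [hmul]
  refine mul_ne_zero ?_ fun h0 => ?_
  · rw [← norm_ne_zero_iff, norm_character]
    exact one_ne_zero
  · rw [h0, Complex.zero_re] at hle
    linarith [mul_pos Real.cos_one_pos hpos]

/-- The product of the window with the conjugate of the window and a small bump near a point where
the window does not vanish. -/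
theorem exists_mul_eq_bump {χ : 𝓢(Euc n, ℂ)} {x₀ : Euc n} (hx₀ : χ x₀ ≠ 0) {r : ℝ} (hr : 0 < r) :
    ∃ (b : 𝓢(Euc n, ℂ)) (g : Euc n → ℝ), (∀ x, b x * χ x = (g x : ℂ)) ∧ Continuous g ∧
      HasCompactSupport g ∧ (∀ x, 0 ≤ g x) ∧ g x₀ ≠ 0 ∧ ∀ x, g x ≠ 0 → ‖x - x₀‖ < r := by
  let β : ContDiffBump x₀ := ⟨r / 2, r, by positivity, by linarith⟩
  have hs : ContDiff ℝ (⊤ : ℕ∞) fun x => starRingEnd ℂ (χ x) * ((β x : ℝ) : ℂ) :=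
    (Complex.conjCLE.contDiff.comp χ.smooth').mul (Complex.ofRealCLM.contDiff.comp β.contDiff)
  have hc : HasCompactSupport fun x => starRingEnd ℂ (χ x) * ((β x : ℝ) : ℂ) :=
    (β.hasCompactSupport.comp_left Complex.ofReal_zero).mul_left
  obtain ⟨b, hb⟩ : ∃ b : 𝓢(Euc n, ℂ), ∀ x, b x = starRingEnd ℂ (χ x) * ((β x : ℝ) : ℂ) :=
    ⟨hc.toSchwartzMap hs, fun x => rfl⟩
  have hgc : Continuous fun x => ‖χ x‖ ^ 2 * β x := by
    have h1 : Continuous fun x => ‖χ x‖ := χ.continuous.norm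
    have h2 : Continuous fun x => β x := β.continuous
    exact (h1.pow 2).mul h2
  have hgs : HasCompactSupport fun x => ‖χ x‖ ^ 2 * β x :=
    HasCompactSupport.mul_left (f := fun x => ‖χ x‖ ^ 2) β.hasCompactSupport
  refine ⟨b, fun x => ‖χ x‖ ^ 2 * β x, fun x => ?_, hgc, hgs, fun x => ?_, ?_, fun x hx => ?_⟩
  · rw [hb, mul_right_comm, Complex.conj_mul']
    push_cast
    rfl
  · exact mul_nonneg (by positivity) β.nonneg
  · change ‖χ x₀‖ ^ 2 * β x₀ ≠ 0
    rw [β.one_of_mem_closedBall (Metric.mem_closedBall_self β.rIn_pos.le), mul_one]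
    exact pow_ne_zero _ (norm_ne_zero_iff.2 hx₀)
  · have : x ∈ Function.support β := fun h => hx (by simp only [h, mul_zero])
    rw [β.support_eq, Metric.mem_ball, dist_eq_norm] at this
    exact this

theorem exists_schwartzUnhat_mul_ne_zero {χ : 𝓢(Euc n, ℂ)} (hχ : χ ≠ 0) (R : ℝ) :
    ∃ b : 𝓢(Euc n, ℂ), ∀ η : Euc n, ‖η‖ ≤ R → schwartzUnhat n (mulSchwartz b χ) η ≠ 0 := by
  obtain ⟨x₀, hx₀⟩ : ∃ x₀, χ x₀ ≠ 0 := by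
    by_contra! h
    exact hχ (by ext x; exact h x)
  obtain ⟨b, g, hb, hgc, hgs, hg0, hgx₀, hr⟩ :=
    exists_mul_eq_bump hx₀ (by positivity : 0 < 1 / (|R| + 1))
  refine ⟨b, fun η hη => ?_⟩
  have h1 : ∫ x, character (-η) x * mulSchwartz b χ x = ∫ x, character (-η) x * (g x : ℂ) := by
    simp only [mulSchwartz_apply, hb]
  rw [schwartzUnhat_apply, h1]
  refine mul_ne_zero inversionConst_ne_zero
    (integral_character_mul_ne_zero hgc hgs hg0 hgx₀ fun x hx => ?_)
  calc ‖x - x₀‖ * ‖-η‖ ≤ 1 / (|R| + 1) * (|R| + 1) := by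
        rw [norm_neg]
        exact mul_le_mul (hr x hx).le (by linarith [le_abs_self R]) (norm_nonneg _) (by positivity)
    _ = 1 := by field_simp

/-- Every smooth symbol of compact support is divisible by the inverse Fourier transform of the
product of the window with a suitable `b`. -/
theorem exists_mul_schwartzUnhat_eq {φ χ : 𝓢(Euc n, ℂ)} (hφ : HasCompactSupport φ) (hχ : χ ≠ 0) :
    ∃ b θ : 𝓢(Euc n, ℂ), ∀ x, θ x * schwartzUnhat n (mulSchwartz b χ) x = φ x := by
  obtain ⟨R, hR⟩ := hφ.isCompact.isBounded.exists_norm_le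
  obtain ⟨b, hb⟩ := exists_schwartzUnhat_mul_ne_zero hχ R
  set m := schwartzUnhat n (mulSchwartz b χ)
  -- The quotient is set to zero where `m` vanishes, which happens only off the support of `φ`.
  have hs : ContDiff ℝ (⊤ : ℕ∞) fun x => φ x * (m x)⁻¹ := by
    rw [contDiff_iff_contDiffAt]
    intro x
    by_cases hx : x ∈ tsupport φ
    · exact φ.smooth'.contDiffAt.mul (m.smooth'.contDiffAt.inv (hb x (hR x hx)))
    · refine contDiffAt_const (c := (0 : ℂ)) |>.congr_of_eventuallyEq ?_
      filter_upwards [(isClosed_tsupport φ).isOpen_compl.mem_nhds hx] with y hy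
      rw [image_eq_zero_of_notMem_tsupport hy, zero_mul]
  have hc : HasCompactSupport fun x => φ x * (m x)⁻¹ := hφ.mul_right
  refine ⟨b, hc.toSchwartzMap hs, fun x => ?_⟩
  change φ x * (m x)⁻¹ * m x = φ x
  by_cases hx : x ∈ tsupport φ
  · rw [inv_mul_cancel_right₀ (hb x (hR x hx))]
  · rw [image_eq_zero_of_notMem_tsupport hx, zero_mul, zero_mul]

end Division

/-! ### The decomposition by a partition of unity on the frequency side -/

section Lower

variable {n : ℕ} (Γ : Submodule ℤ (Euc n)) [DiscreteTopology Γ] [IsZLattice ℝ Γ]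

/-- The norms of the pieces `φ(D - γ) u` are summable when `u` belongs to `S_w^p`: the bounds for
the single pieces are weights in front of `U_{χ,p}`, and these weights have a bounded sum. -/
theorem exists_tsum_lpSupNorm_multiplier_le {φ χ : 𝓢(Euc n, ℂ)} (hφ : HasCompactSupport φ)
    (hχ : χ ≠ 0) :
    ∃ C : ℝ≥0, ∀ (p : ℝ≥0∞) (_ : 1 ≤ p) (u : 𝓢'(Euc n, ℂ)),
      ∑' γ : Γ, lpSupNorm p (fun x => ‖multiplier (translate (γ : Euc n) φ) u x‖ₑ)
        ≤ C * swNorm p χ u := by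
  obtain ⟨b, θ, h⟩ := exists_mul_schwartzUnhat_eq hφ hχ
  obtain ⟨K, hK⟩ := exists_tsum_enorm_le Γ (schwartzUnhat n b)
  set I := ∫⁻ z, ‖(inversionConst n : ℂ) ^ 2‖ₑ * ‖schwartzHat n θ z‖ₑ with hIdef
  have hI : I ≠ ∞ := by
    rw [hIdef, lintegral_const_mul' _ _ enorm_ne_top]
    exact ENNReal.mul_ne_top enorm_ne_top (schwartzHat n θ).integrable.hasFiniteIntegral.ne
  refine ⟨K * I.toNNReal, fun p hp u => ?_⟩
  have ha : ∀ γ : Γ, Measurable fun ξ : Euc n => ‖schwartzUnhat n b (ξ - (γ : Euc n))‖ₑ :=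
    fun γ => ((schwartzUnhat n b).continuous.comp (by fun_prop :
      Continuous fun ξ : Euc n => ξ - (γ : Euc n))).measurable.enorm
  have hw := (measurable_windowFun p χ u).mul_const I
  calc _ ≤ ∑' γ : Γ, ∫⁻ ξ, ‖schwartzUnhat n b (ξ - (γ : Euc n))‖ₑ * (windowFun p χ u ξ * I) :=
        ENNReal.tsum_le_tsum fun γ => lpSupNorm_multiplier_translate_le h hp u γ
    _ = ∫⁻ ξ, (∑' γ : Γ, ‖schwartzUnhat n b (ξ - (γ : Euc n))‖ₑ) * (windowFun p χ u ξ * I) := by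
        simp only [← ENNReal.tsum_mul_right]
        exact (lintegral_tsum fun γ => ((ha γ).mul hw).aemeasurable).symm
    _ ≤ ∫⁻ ξ, K * (windowFun p χ u ξ * I) :=
        lintegral_mono fun ξ => mul_le_mul_left (hK ξ) _
    _ = K * I.toNNReal * swNorm p χ u := by
        rw [lintegral_const_mul' _ _ ENNReal.coe_ne_top, lintegral_mul_const' _ _ hI,
          ENNReal.coe_toNNReal hI, swNorm]
        ring
    _ = _ := by rw [ENNReal.coe_mul]

/-- The spectrum of `φ(D - γ) u` lies in the translate by `γ` of the support of `φ`. -/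
theorem dsupport_subset_of_apply_eq {φ : 𝓢(Euc n, ℂ)} {u f : 𝓢'(Euc n, ℂ)} (γ : Euc n)
    (h : ∀ ψ, f ψ = u (schwartzHat n (mulSchwartz (translate γ φ) (schwartzUnhat n ψ)))) :
    dsupport (distHat f) ⊆ (fun x => γ + x) '' tsupport φ := by
  rw [← Set.compl_subset_compl, dsupport_compl_eq]
  have hclosed : IsClosed ((fun x => γ + x) '' tsupport φ) :=
    (Homeomorph.addLeft γ).isClosedMap _ (isClosed_tsupport φ)
  refine Set.subset_sUnion_of_mem ⟨fun θ hθ => ?_, hclosed.isOpen_compl⟩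
  have h0 : mulSchwartz (translate γ φ) θ = 0 := by
    ext x
    rw [mulSchwartz_apply, SchwartzMap.compSubConstCLM_apply]
    by_cases hx : x ∈ tsupport θ
    · have : x - γ ∉ tsupport φ := fun hx' => hθ hx ⟨x - γ, hx', by simp⟩
      rw [image_eq_zero_of_notMem_tsupport this, zero_mul]; rfl
    · rw [image_eq_zero_of_notMem_tsupport hx, mul_zero]; rfl
  rw [distHat_apply, h, schwartzUnhat_schwartzHat, h0, map_zero, map_zero]

/-- The decomposition of the elements of `S_w^p` by a partition of unity on the frequency side. It
does not involve the window, so that one decomposition satisfies the bounds for all windows. -/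
theorem exists_isSpectralDecomposition :
    ∃ Q₀ : Set (Euc n), IsCompact Q₀ ∧ ∃ C : 𝓢(Euc n, ℂ) → ℝ≥0,
      ∀ (p : ℝ≥0∞) [Fact (1 ≤ p)] (u : 𝓢'(Euc n, ℂ)), MemSw p u →
        ∃ v : Γ → Lp ℂ p (volume : Measure (Euc n)), IsSpectralDecomposition Γ Q₀ p u v ∧
          ∀ χ : 𝓢(Euc n, ℂ), IsWindow χ → ∑' γ : Γ, ‖v γ‖ₑ ≤ C χ * swNorm p χ u := by
  obtain ⟨φ, hφ, hsum⟩ := exists_partition Γ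
  choose! C hC using fun (χ : 𝓢(Euc n, ℂ)) (hχ : IsWindow χ) =>
    exists_tsum_lpSupNorm_multiplier_le Γ hφ hχ.2
  refine ⟨tsupport φ, hφ, C, fun p hp u hu => ?_⟩
  obtain ⟨χ₀, hχ₀, hfin⟩ := hu
  have hle : ∀ χ, IsWindow χ →
      ∑' γ : Γ, eLpNorm (multiplier (translate (γ : Euc n) φ) u) p volume
        ≤ C χ * swNorm p χ u := fun χ hχ =>
    (ENNReal.tsum_le_tsum fun γ => eLpNorm_le_lpSupNorm hp.out _).trans (hC χ hχ p hp.out u)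
  have hlt : ∑' γ : Γ, eLpNorm (multiplier (translate (γ : Euc n) φ) u) p volume < ∞ :=
    (hle χ₀ hχ₀).trans_lt (ENNReal.mul_lt_top ENNReal.coe_lt_top hfin)
  have hmem : ∀ γ : Γ, MemLp (multiplier (translate (γ : Euc n) φ) u) p volume := fun γ =>
    ⟨(continuous_multiplier _ u).aestronglyMeasurable, (ENNReal.le_tsum γ).trans_lt hlt⟩
  let v : Γ → Lp ℂ p (volume : Measure (Euc n)) := fun γ => (hmem γ).toLp
  have hv : ∀ γ : Γ, ‖v γ‖ₑ = eLpNorm (multiplier (translate (γ : Euc n) φ) u) p volume :=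
    fun γ => Lp.enorm_toLp _
  have happly : ∀ (γ : Γ) (ψ : 𝓢(Euc n, ℂ)), Lp.toTemperedDistribution (v γ) ψ
      = u (schwartzHat n (mulSchwartz (translate (γ : Euc n) φ) (schwartzUnhat n ψ))) :=
    fun γ ψ => by
      rw [apply_schwartzHat_mul_schwartzUnhat, Lp.toTemperedDistribution_apply]
      refine integral_congr_ae ?_
      filter_upwards [(hmem γ).coeFn_toLp] with x hx
      rw [hx, smul_eq_mul]
  refine ⟨v, ⟨fun γ => dsupport_subset_of_apply_eq _ (happly γ), ?_, ?_⟩, fun χ hχ => ?_⟩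
  · simpa only [hv] using hlt
  · refine (PointwiseConvergenceCLM.tendsto_iff_forall_tendsto ..).2 fun ψ => ?_
    have h1 : HasSum (fun γ : Γ => u (schwartzHat n (mulSchwartz (translate (γ : Euc n) φ)
        (schwartzUnhat n ψ)))) (u ψ) := by
      have h2 := hasSum_apply_mul_translate hsum
        ((show 𝓢(Euc n, ℂ) →L[ℂ] ℂ from u).comp (schwartzHat n)) (schwartzUnhat n ψ)
      rwa [ContinuousLinearMap.comp_apply, schwartzHat_schwartzUnhat] at h2
    refine Filter.Tendsto.congr (fun s => ?_) h1
    change _ = PointwiseConvergenceCLM.evalCLM (RingHom.id ℂ) ℂ ψ (∑ γ ∈ s, _)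
    rw [map_sum]
    exact Finset.sum_congr rfl fun γ _ => (happly γ ψ).symm
  · simpa only [hv] using hle χ hχ

/-- A distribution with a decomposition belongs to `S_w^p`. -/
theorem IsSpectralDecomposition.memSw {Γ : Submodule ℤ (Euc n)} [Countable Γ] {Q : Set (Euc n)}
    (hQ : IsCompact Q) {p : ℝ≥0∞} [Fact (1 ≤ p)] {u : 𝓢'(Euc n, ℂ)}
    {v : Γ → Lp ℂ p (volume : Measure (Euc n))} (h : IsSpectralDecomposition Γ Q p u v) :
    MemSw p u := by
  obtain ⟨ρ, hρ, hρ1⟩ := exists_mollifier n one_pos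
  obtain ⟨C, hC⟩ := exists_swNorm_le (Γ := Γ) hQ ρ
  refine ⟨ρ, ⟨(isCompact_closedBall 0 1).of_isClosed_subset (isClosed_tsupport _) hρ, ?_⟩,
    (hC p u v h).trans_lt (ENNReal.mul_lt_top ENNReal.coe_lt_top h.norm_summable)⟩
  rintro rfl
  simp at hρ1

end Lower

end SpectralSw

end

theorem mainTheorem1 (n : ℕ) (Γ : Submodule ℤ (EuclideanSpace ℝ (Fin n)))
    [DiscreteTopology Γ] [IsZLattice ℝ Γ] :
    -- membership is equivalent to the existence of a decomposition for some compact set `Q`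
    (∀ (p : ℝ≥0∞) [Fact (1 ≤ p)] (u : 𝓢'(EuclideanSpace ℝ (Fin n), ℂ)),
      SpectralSw.MemSw p u ↔
        ∃ Q : Set (EuclideanSpace ℝ (Fin n)), IsCompact Q ∧
          ∃ v, SpectralSw.IsSpectralDecomposition Γ Q p u v) ∧
    -- one compact set `Q₀`, depending only on the lattice, serves all elements of `S_w^p`,
    -- with control of the sum of the norms by the norm in `S_w^p`
    (∃ Q₀ : Set (EuclideanSpace ℝ (Fin n)), IsCompact Q₀ ∧
      ∃ C : 𝓢(EuclideanSpace ℝ (Fin n), ℂ) → ℝ≥0,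
        ∀ (p : ℝ≥0∞) [Fact (1 ≤ p)] (u : 𝓢'(EuclideanSpace ℝ (Fin n), ℂ)),
          SpectralSw.MemSw p u →
            ∃ v, SpectralSw.IsSpectralDecomposition Γ Q₀ p u v ∧
              ∀ χ : 𝓢(EuclideanSpace ℝ (Fin n), ℂ), SpectralSw.IsWindow χ →
                ∑' γ : Γ, ‖v γ‖ₑ ≤ C χ * SpectralSw.swNorm p χ u) ∧
    -- conversely the norm in `S_w^p` is controlled by every decomposition
    (∀ Q : Set (EuclideanSpace ℝ (Fin n)), IsCompact Q →
      ∀ χ : 𝓢(EuclideanSpace ℝ (Fin n), ℂ), SpectralSw.IsWindow χ →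
        ∃ C : ℝ≥0, ∀ (p : ℝ≥0∞) [Fact (1 ≤ p)] (u : 𝓢'(EuclideanSpace ℝ (Fin n), ℂ)) v,
          SpectralSw.IsSpectralDecomposition Γ Q p u v →
            SpectralSw.swNorm p χ u ≤ C * ∑' γ : Γ, ‖v γ‖ₑ) := by
  obtain ⟨Q₀, hQ₀, C, hC⟩ := SpectralSw.exists_isSpectralDecomposition Γ
  refine ⟨fun p _ u => ⟨fun hu => ?_, fun ⟨Q, hQ, v, hv⟩ => hv.memSw hQ⟩, ⟨Q₀, hQ₀, C, hC⟩,
    fun Q hQ χ _ => SpectralSw.exists_swNorm_le hQ χ⟩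
  obtain ⟨v, hv, -⟩ := hC p u hu
  exact ⟨Q₀, hQ₀, v, hv⟩
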